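/- Let $0<s<1$, $n>2s$, $2^*_s=\frac{2n}{n-2s}$, and let $K:\mathbb R^n\to(0,\infty)$ be measurable and even, with $K(x)|x|^{n+2s}\ge\lambda$ a.e. for some $\lambda>0$ and $\min\{|x|^2,1\}K\in L^1(\mathbb R^n)$. Put $[u,v]=\iint (u(x)-u(y))(v(x)-v(y))K(x-y)\,dx\,dy$, let $X=\{u\in L^2(\mathbb R^n): [u,u]<\infty\}$ with $\|u\|_X^2=\int u^2+[u,u]$, let $X_0(B)$ be the set of $u\in X$ vanishing a.e. outside the unit ball $B$, and let $S$ be the best constant with $\|u\|_{2^*_s}^2\le S\|u\|_X^2$ for all $u\in X$. Let $f:\mathbb R\to\mathbb R$ be continuous with $|f(t)|\le c_0|t|^{p-1}$ for all $t$, where $2<p<2^*_s$; $\theta F(t)\le tf(t)$ for all $t>0$, where $\theta>2$ and $F(t)=\int_0^tf$; $f(t)>0$ for $t>0$ and $f(t)=0$ for $t<0$. Let $V:\mathbb R^n\to\mathbb R$ be continuous with $\inf V>0$ and $V\le V_\infty$ on $B$, where $V_\infty>0$. Let $E=\{u\in X:\int Vu^2<\infty\}$ with $\|u\|^2=[u,u]+\int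 Vu^2$. Put $$I_0(u)=\tfrac12\Big([u,u]+\int V_\infty u^2\Big)-\int F(u),\qquad u\in X_0(B),$$ fix $e\in X_0(B)$ with $I_0(e)<0$, and let $d=\inf_\gamma\max_{t\in[0,1]}I_0(\gamma(t))$ over all $\gamma\in C([0,1],X_0(B))$ with $\gamma(0)=0$, $\gamma(1)=e$. Let $k=\frac{2\theta}{\theta-2}$ and $R\ge1$. Put $g(x,t)=f(t)$ if $|x|\le R$ or $kf(t)\le V(x)t$, and $g(x,t)=\frac{V(x)}{k}t$ otherwise; $G(x,t)=\int_0^tg(x,\tau)\,d\tau$; $J(u)=\frac12\|u\|^2-\int G(x,u)\,dx$ on $E$; and let $c=\inf_\gamma\max_{t\in[0,1]}J(\gamma(t))$ over all $\gamma\in C([0,1],E)$ with $\gamma(0)=0$, $\gamma(1)=e$. Then there are a function $M=M(q,r)$, nondecreasing in $r\ge0$ for every $q>\frac n{2s}$, and a constant $C>0$, both depending only on $n,s,K$, such that the following holds for all $p,c_0,\theta,f,V,V_\infty,e,R$ as above. Let $u\in E$ be a solution of the auxiliary problem at the mountain pass level (in particular, the nonnegative one), that is, $[u,v]+\int Vuv=\int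 g(x,u)v$ for all $v\in E$, and $J(u)=c$. With $q=\frac{2^*_s}{p-2}$ and $h=c_0|u|^{p-2}$ one has $q>\frac n{2s}$, $h\in L^q(\mathbb R^n)$, and $$\|u\|_\infty\le M(q,\|h\|_{L^q})\,(2Skd)^{1/2},\qquad \|h\|_{L^q}\le c_0\,(C\cdot 2Skd)^{\frac{p-2}2}.$$ In particular, $\|u\|_\infty$ is bounded uniformly in $R\ge1$. -/

import Mathlib

open MeasureTheory Filter Topology Set
open scoped ENNReal unitInterval

noncomputable section

namespace NonlocalSchrodinger

/-- Euclidean space `ℝⁿ`. -/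
abbrev Rn (n : ℕ) : Type := EuclideanSpace ℝ (Fin n)

/-! ### Standing assumptions -/

/-- The kernel `K : ℝⁿ → (0, ∞)` is measurable and even, `K(x)|x|^{n+2s}` is a.e. bounded below
by a positive constant, and `min(|x|², 1) K(x)` is integrable. -/
structure IsKernel (n : ℕ) (s : ℝ) (K : Rn n → ℝ) : Prop where
  pos : ∀ x, 0 < K x
  measurable : Measurable K
  even : ∀ x, K x = K (-x)
  lower : ∃ lam : ℝ, 0 < lam ∧ ∀ᵐ x ∂(volume : Measure (Rn n)),
    lam ≤ K x * ‖x‖ ^ ((n : ℝ) + 2 * s)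
  integrable : Integrable (fun x => min (‖x‖ ^ 2) 1 * K x) (volume : Measure (Rn n))

/-- The potential `V` is continuous, bounded below by a positive constant, and at most
`Vinf > 0` on the unit ball. -/
structure IsPotential {n : ℕ} (V : Rn n → ℝ) (Vinf : ℝ) : Prop where
  continuous : Continuous V
  lower : ∃ δ : ℝ, 0 < δ ∧ ∀ x, δ ≤ V x
  Vinf_pos : 0 < Vinf
  upper : ∀ x ∈ Metric.ball (0 : Rn n) 1, V x ≤ Vinf

/-- The fractional critical exponent `2n/(n-2s)` (used for `2s < n` only). -/
def critExp (n : ℕ) (s : ℝ) : ℝ := 2 * n / (n - 2 * s)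

/-- The primitive `F(t) = ∫₀ᵗ f`. -/
def primitive (f : ℝ → ℝ) (t : ℝ) : ℝ := ∫ τ in (0 : ℝ)..t, f τ

/-- The nonlinearity `f` is continuous, has subcritical growth `|f(t)| ≤ c₀|t|^{p-1}` with
`2 < p < 2n/(n-2s)`, satisfies the superquadraticity condition `θ F(t) ≤ t f(t)` for `t > 0`
with `θ > 2`, is positive on `(0, ∞)` and vanishes on `(-∞, 0)`. -/
structure IsNonlinearity (n : ℕ) (s p c₀ θ : ℝ) (f : ℝ → ℝ) : Prop where
  continuous : Continuous f
  two_lt_p : 2 < p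
  p_lt : p < critExp n s
  growth : ∀ t, |f t| ≤ c₀ * |t| ^ (p - 1)
  two_lt_θ : 2 < θ
  superquadratic : ∀ t, 0 < t → θ * primitive f t ≤ t * f t
  pos : ∀ t, 0 < t → 0 < f t
  zero : ∀ t, t < 0 → f t = 0

/-! ### Function spaces -/

/-- The bilinear form `[u, v] = ∬ (u(x)-u(y))(v(x)-v(y))K(x-y) dx dy`. -/
def form {n : ℕ} (K : Rn n → ℝ) (u v : Rn n → ℝ) : ℝ :=
  ∫ z : Rn n × Rn n, (u z.1 - u z.2) * (v z.1 - v z.2) * K (z.1 - z.2)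

/-- Membership in `X`: `u ∈ L²(ℝⁿ)` and `(u(x)-u(y))√K(x-y) ∈ L²(ℝⁿ × ℝⁿ)`. -/
def MemX {n : ℕ} (K : Rn n → ℝ) (u : Rn n → ℝ) : Prop :=
  MemLp u 2 (volume : Measure (Rn n)) ∧
    MemLp (fun z : Rn n × Rn n => (u z.1 - u z.2) * √(K (z.1 - z.2))) 2
      (volume : Measure (Rn n × Rn n))

/-- The norm of `X`. -/
def normX {n : ℕ} (K : Rn n → ℝ) (u : Rn n → ℝ) : ℝ :=
  √((∫ x, u x ^ 2) + form K u u)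

/-- Membership in `X₀(Ω)`: elements of `X` vanishing (a.e.) outside `Ω`. On this space the
usual norm of `X₀(Ω)` coincides with that of `X`. -/
def MemX₀ {n : ℕ} (K : Rn n → ℝ) (Ω : Set (Rn n)) (u : Rn n → ℝ) : Prop :=
  MemX K u ∧ ∀ᵐ x ∂(volume : Measure (Rn n)), x ∉ Ω → u x = 0

/-- Membership in `E`: elements of `X` with `∫ V u² < ∞`. -/
def MemE {n : ℕ} (K V : Rn n → ℝ) (u : Rn n → ℝ) : Prop :=
  MemX K u ∧ Integrable (fun x => V x * u x ^ 2) (volume : Measure (Rn n))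

/-- The norm of `E`. -/
def normE {n : ℕ} (K V : Rn n → ℝ) (u : Rn n → ℝ) : ℝ :=
  √(form K u u + ∫ x, V x * u x ^ 2)

/-- The Sobolev constant: the best `S` with `‖u‖²_{2n/(n-2s)} ≤ S ‖u‖²_X` for all `u ∈ X`. -/
def sobolevConst (n : ℕ) (s : ℝ) (K : Rn n → ℝ) : ℝ :=
  sInf {C : ℝ | 0 ≤ C ∧ ∀ u : Rn n → ℝ, MemX K u →
    eLpNorm u (ENNReal.ofReal (critExp n s)) (volume : Measure (Rn n)) ^ 2
      ≤ ENNReal.ofReal (C * normX K u ^ 2)}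

/-! ### Mountain pass levels -/

/-- Paths `γ : [0,1] → W` from `0` to `e`, continuous for the norm `N`, where the function space
is given by its membership predicate `W` (functions are identified when equal a.e.). -/
def paths {n : ℕ} (W : (Rn n → ℝ) → Prop) (N : (Rn n → ℝ) → ℝ) (e : Rn n → ℝ) :
    Set (I → Rn n → ℝ) :=
  {γ | (∀ t, W (γ t)) ∧
    (∀ t₀, Tendsto (fun t => N (γ t - γ t₀)) (𝓝 t₀) (𝓝 0)) ∧
    γ 0 =ᵐ[volume] 0 ∧ γ 1 =ᵐ[volume] e}

/-- The mountain pass level `inf_{γ ∈ Γ} max_{t ∈ [0,1]} Φ(γ(t))`. -/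
def mountainPassLevel {n : ℕ} (Γ : Set (I → Rn n → ℝ)) (Φ : (Rn n → ℝ) → ℝ) : ℝ :=
  sInf ((fun γ => ⨆ t : I, Φ (γ t)) '' Γ)

/-! ### The problem in the unit ball -/

/-- The energy `I₀(u) = ½([u,u] + ∫ V∞ u²) - ∫ F(u)`. -/
def ballEnergy {n : ℕ} (K : Rn n → ℝ) (Vinf : ℝ) (f : ℝ → ℝ) (u : Rn n → ℝ) : ℝ :=
  1 / 2 * (form K u u + ∫ x, Vinf * u x ^ 2) - ∫ x, primitive f (u x)

/-- The mountain pass level `d` of `I₀` on `X₀(B)`, `B` the unit ball, for paths from `0`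
to `e`. -/
def ballLevel {n : ℕ} (K : Rn n → ℝ) (Vinf : ℝ) (f : ℝ → ℝ) (e : Rn n → ℝ) : ℝ :=
  mountainPassLevel (paths (MemX₀ K (Metric.ball 0 1)) (normX K) e) (ballEnergy K Vinf f)

/-! ### The auxiliary problem -/

/-- `k = 2θ/(θ-2)`. -/
def kConst (θ : ℝ) : ℝ := 2 * θ / (θ - 2)

/-- The truncated nonlinearity: `f(t)` if `k f(t) ≤ V(x) t`, and `V(x) t / k` otherwise. -/
def fTrunc {n : ℕ} (V : Rn n → ℝ) (θ : ℝ) (f : ℝ → ℝ) (x : Rn n) (t : ℝ) : ℝ :=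
  open Classical in
  if kConst θ * f t ≤ V x * t then f t else V x / kConst θ * t

/-- The nonlinearity `g` of the auxiliary problem: `f(t)` for `|x| ≤ R`, truncated outside. -/
def gAux {n : ℕ} (V : Rn n → ℝ) (θ R : ℝ) (f : ℝ → ℝ) (x : Rn n) (t : ℝ) : ℝ :=
  open Classical in
  if ‖x‖ ≤ R then f t else fTrunc V θ f x t

/-- The energy `J(u) = ½‖u‖²_E - ∫ G(x,u)`, with `G(x,t) = ∫₀ᵗ g(x,τ) dτ`. -/
def auxEnergy {n : ℕ} (K V : Rn n → ℝ) (θ R : ℝ) (f : ℝ → ℝ) (u : Rn n → ℝ) : ℝ :=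
  1 / 2 * normE K V u ^ 2 - ∫ x, primitive (gAux V θ R f x) (u x)

/-- The mountain pass level `c` of `J` on `E`, for paths from `0` to `e`. -/
def auxLevel {n : ℕ} (K V : Rn n → ℝ) (θ R : ℝ) (f : ℝ → ℝ) (e : Rn n → ℝ) : ℝ :=
  mountainPassLevel (paths (MemE K V) (normE K V) e) (auxEnergy K V θ R f)

/-- `u ∈ E` is a weak solution of the auxiliary problem `-L_K u + V u = g(x,u)`, that is
`J'(u) v = 0` for all `v ∈ E`. -/
def IsAuxSolution {n : ℕ} (K V : Rn n → ℝ) (θ R : ℝ) (f : ℝ → ℝ) (u : Rn n → ℝ) : Prop :=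
  MemE K V u ∧ ∀ v, MemE K V v →
    form K u v + ∫ x, V x * u x * v x = ∫ x, gAux V θ R f x (u x) * v x

end NonlocalSchrodinger

end

namespace NonlocalSchrodinger

variable {n : ℕ} {s : ℝ} {K : Rn n → ℝ}

/-! ### The critical exponent -/

/-! The estimate combines a Sobolev inequality, an energy bound independent of `R`, and a De Giorgi
iteration. Write P for the critical exponent.

Sobolev: the lower bound on `K` yields ‖u‖_P² ≤ A [u,u] with no L² term (`sobolev_lintegral`). If
|u(x)| = t, Chebyshev makes {|u| ≥ t/2} fill at most half of a suitable ball around x. On the rest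
of that ball the difference quotient is large, which bounds |u(x)|^P by the inner integral of [u,u];
integrating in x closes the estimate.

Energy: testing the equation with u and using the superquadraticity of f inside the ball of radius R
and the truncation outside it gives ‖u‖² ≤ 2k J(u) (`IsAuxSolution.normE_sq_le`). On functions
supported in the unit ball, J ≤ I₀, because g = f and V ≤ V∞ there; hence c ≤ d
(`auxLevel_le_ballLevel`) and [u,u] ≤ 2kd for every R ≥ 1.

Boundedness: dropping the potential leaves u and -u as subsolutions of a linear problem with weight
H = c₀|u|^(p-2). This weight lies in L^q with q = P/(p-2), and subcriticality of p is exactly q >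
n/(2s). Testing with (w-ℓ)⁺ and applying Hölder gives a recursion between truncated L^P norms with
exponent 2+η > 2 (`level_step`), so the norms decay geometrically along levels increasing to a
multiple of ‖w‖_P (`IsSubsolution.le`). That multiple depends only on A, η and ‖H‖_q, and ‖u‖_P is
controlled by the energy. -/

theorem critExp_gt_two (hs0 : 0 < s) (hn : 2 * s < n) : 2 < critExp n s := by
  unfold critExp
  rw [lt_div_iff₀ (by linarith)]
  linarith

theorem critExp_mul (hs0 : 0 < s) (hn : 2 * s < n) :
    critExp n s * (2 * s / n) = critExp n s - 2 := by
  have h1 : (0 : ℝ) < n - 2 * s := by linarith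
  have h2 : (0 : ℝ) < n := by linarith
  unfold critExp
  field_simp
  ring

theorem one_sub_eq_two_div_critExp (hs0 : 0 < s) (hn : 2 * s < n) :
    1 - 2 * s / n = 2 / critExp n s := by
  have h1 : (0 : ℝ) < n - 2 * s := by linarith
  have h2 : (0 : ℝ) < n := by linarith
  unfold critExp
  field_simp

/-! ### The homogeneous fractional Sobolev inequality -/

/-- The unit ball volume as a real number. -/
noncomputable def unitVol (n : ℕ) : ℝ := (volume (Metric.ball (0 : Rn n) 1)).toReal

theorem unitVol_pos (n : ℕ) : 0 < unitVol n :=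
  ENNReal.toReal_pos (Metric.measure_ball_pos _ _ one_pos).ne' measure_ball_lt_top.ne

theorem volume_ball_eq (x : Rn n) {r : ℝ} (hr : 0 < r) :
    volume (Metric.ball x r) = ENNReal.ofReal (r ^ n * unitVol n) := by
  rw [Measure.addHaar_ball_of_pos _ _ hr, ENNReal.ofReal_mul (by positivity), unitVol,
    ENNReal.ofReal_toReal measure_ball_lt_top.ne]
  simp

/-- The constant in the homogeneous Sobolev inequality, for a kernel with lower bound `lam`. -/
noncomputable def gagliardoConst (n : ℕ) (s lam : ℝ) : ℝ :=
  8 / (lam * unitVol n) * (2 / unitVol n) ^ (2 * s / n) * 2 ^ (critExp n s - 2)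

theorem gagliardoConst_pos (n : ℕ) (s : ℝ) {lam : ℝ} (hlam : 0 < lam) : 0 < gagliardoConst n s lam := by
  have := unitVol_pos n
  unfold gagliardoConst
  positivity

/-- The arithmetic of the pointwise bound: Z is the n-th power of the radius used there. Since P ·
2s/n = P - 2, the powers of Q cancel and t^P remains. -/
theorem gagliardoConst_identity (hs0 : 0 < s) (hn : 2 * s < n) {lam t Q Z : ℝ} (hlam : 0 < lam)
    (ht : 0 < t) (hQ : 0 < Q) (hZ : Z = 2 * Q / (unitVol n * (t / 2) ^ critExp n s)) :
    gagliardoConst n s lam * Q ^ (2 * s / n) *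
      ((t ^ 2 / 4 * (lam / Z ^ (1 + 2 * s / n))) * (Z * unitVol n / 2)) = t ^ critExp n s := by
  have hb := unitVol_pos n
  have hZ0 : 0 < Z := by rw [hZ]; positivity
  have h1 : Z ^ (2 * s / n) * (t ^ (critExp n s - 2) / 2 ^ (critExp n s - 2)) =
      (2 / unitVol n) ^ (2 * s / n) * Q ^ (2 * s / n) := by
    have : Z = (2 / unitVol n) * Q / (t / 2) ^ critExp n s := by rw [hZ]; field_simp
    rw [this, Real.div_rpow (by positivity) (by positivity), ← Real.rpow_mul (by positivity),
      critExp_mul hs0 hn, Real.mul_rpow (by positivity) hQ.le, Real.div_rpow ht.le (by norm_num)]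
    field_simp
  have h2 : t ^ critExp n s = t ^ 2 * t ^ (critExp n s - 2) := by
    rw [← Real.rpow_natCast t 2, ← Real.rpow_add ht]; norm_num
  rw [Real.rpow_add hZ0, Real.rpow_one, h2, gagliardoConst]
  have h3 : 0 < Z ^ (2 * s / n) := by positivity
  have h4 : (0 : ℝ) < 2 ^ (critExp n s - 2) := by positivity
  have h5 : t ^ (critExp n s - 2) * Z ^ (2 * s / n) =
    (2 / unitVol n) ^ (2 * s / n) * Q ^ (2 * s / n) * 2 ^ (critExp n s - 2) := by
    rw [← h1]; field_simp
  generalize (2 / unitVol n) ^ (2 * s / n) = A at *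
  generalize Q ^ (2 * s / n) = B at *
  generalize Z ^ (2 * s / n) = D at *
  generalize (2 : ℝ) ^ (critExp n s - 2) = F at *
  generalize t ^ (critExp n s - 2) = G at *
  field_simp
  linear_combination (-8) * h5

/-- Pointwise bound of `|u|^{2*}` by the density of the Gagliardo seminorm. -/
theorem rpow_le_mul_lintegral (hs0 : 0 < s) (hn : 2 * s < n) (hK : IsKernel n s K) {lam : ℝ}
    (hlam : 0 < lam) (hlow : ∀ᵐ x, lam ≤ K x * ‖x‖ ^ ((n : ℝ) + 2 * s))
    {u : Rn n → ℝ} (hu : AEMeasurable u) {Q : ℝ} (hQ : 0 < Q)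
    (huQ : ∫⁻ y, ENNReal.ofReal (|u y| ^ critExp n s) ≤ ENNReal.ofReal Q) (x : Rn n) :
    ENNReal.ofReal (|u x| ^ critExp n s) ≤
      ENNReal.ofReal (gagliardoConst n s lam * Q ^ (2 * s / n)) *
        ∫⁻ y, ENNReal.ofReal ((u x - u y) ^ 2 * K (x - y)) := by
  have hP := critExp_gt_two hs0 hn
  have hb := unitVol_pos n
  have hn0 : (0 : ℝ) < n := by linarith
  have hnN : n ≠ 0 := by rintro rfl; simp at hn0
  rcases (abs_nonneg (u x)).eq_or_lt with h0 | ht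
  · rw [← h0, Real.zero_rpow (by linarith)]; simp
  set t := |u x| with htdef
  set P := critExp n s with hPdef
  -- The ball of radius r = Z^(1/n) has twice the volume that Chebyshev allows for {|u| ≥ t/2}.
  set Z := 2 * Q / (unitVol n * (t / 2) ^ P) with hZ
  have hZ0 : 0 < Z := by positivity
  set r := Z ^ (1 / (n : ℝ)) with hr
  have hr0 : 0 < r := by positivity
  have hrn : r ^ n = Z := by
    rw [hr, ← Real.rpow_natCast, ← Real.rpow_mul hZ0.le, one_div_mul_cancel hn0.ne', Real.rpow_one]
  have hrns : r ^ ((n : ℝ) + 2 * s) = Z ^ (1 + 2 * s / n) := by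
    rw [hr, ← Real.rpow_mul hZ0.le]; congr 1; field_simp
  set T : Set (Rn n) := {y | ENNReal.ofReal ((t / 2) ^ P) ≤ ENNReal.ofReal (|u y| ^ P)} with hT
  have hmeas : AEMeasurable (fun y => ENNReal.ofReal (|u y| ^ P)) :=
    (hu.abs.pow_const P).ennreal_ofReal
  have hvT : volume T ≤ ENNReal.ofReal (Z * unitVol n / 2) := by
    have h1 := (mul_meas_ge_le_lintegral₀ hmeas (ENNReal.ofReal ((t / 2) ^ P))).trans huQ
    have h2 : Z * unitVol n / 2 = Q / (t / 2) ^ P := by rw [hZ]; field_simp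
    rw [h2, ENNReal.ofReal_div_of_pos (by positivity)]
    rw [ENNReal.le_div_iff_mul_le (Or.inl (by simp; positivity)) (Or.inl ENNReal.ofReal_ne_top),
      mul_comm]
    exact h1
  have hvB : volume (Metric.ball x r) = ENNReal.ofReal (Z * unitVol n) := by
    rw [volume_ball_eq x hr0, hrn]
  have hvA : ENNReal.ofReal (Z * unitVol n / 2) ≤ volume (Metric.ball x r \ T) := by
    refine le_trans ?_ le_measure_sdiff
    rw [hvB]
    refine le_trans ?_ (tsub_le_tsub_left hvT _)
    rw [← ENNReal.ofReal_sub _ (by positivity)]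
    apply ENNReal.ofReal_le_ofReal
    linarith
  have hlow' : ∀ᵐ y, lam ≤ K (x - y) * ‖x - y‖ ^ ((n : ℝ) + 2 * s) :=
    (quasiMeasurePreserving_sub_left volume x).ae hlow
  have hTm : NullMeasurableSet T := nullMeasurableSet_le aemeasurable_const hmeas
  have hint : ENNReal.ofReal (t ^ 2 / 4 * (lam / Z ^ (1 + 2 * s / n))) *
      volume (Metric.ball x r \ T) ≤ ∫⁻ y, ENNReal.ofReal ((u x - u y) ^ 2 * K (x - y)) := by
    rw [← setLIntegral_const]
    refine le_trans ?_ (setLIntegral_le_lintegral (Metric.ball x r \ T) _)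
    refine lintegral_mono_ae ?_
    have hS : NullMeasurableSet (Metric.ball x r \ T) :=
      measurableSet_ball.nullMeasurableSet.diff hTm
    filter_upwards [ae_restrict_of_ae hlow', ae_restrict_mem₀ hS] with y hy hyA
    apply ENNReal.ofReal_le_ofReal
    have hyT : |u y| < t / 2 := by
      by_contra! hc
      apply hyA.2
      exact ENNReal.ofReal_le_ofReal (Real.rpow_le_rpow (by positivity) hc (by linarith))
    have h1 : t ^ 2 / 4 ≤ (u x - u y) ^ 2 := by
      have h2 : t / 2 ≤ |u x - u y| := by
        have := abs_sub_abs_le_abs_sub (u x) (u y)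
        linarith
      rw [← sq_abs (u x - u y)]
      nlinarith
    have h3 : lam / Z ^ (1 + 2 * s / n) ≤ K (x - y) := by
      rw [← hrns, div_le_iff₀ (by positivity)]
      refine hy.trans (mul_le_mul_of_nonneg_left ?_ (hK.pos _).le)
      refine Real.rpow_le_rpow (norm_nonneg _) ?_ (by positivity)
      have := hyA.1
      rw [Metric.mem_ball, dist_comm, dist_eq_norm] at this
      exact this.le
    exact mul_le_mul h1 h3 (by positivity) (sq_nonneg _)
  have hC := gagliardoConst_pos n s hlam
  rw [← gagliardoConst_identity hs0 hn hlam ht hQ hZ, ENNReal.ofReal_mul (by positivity)]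
  gcongr
  rw [ENNReal.ofReal_mul (by positivity)]
  exact (by gcongr : _ ≤ _ * volume (Metric.ball x r \ T)).trans hint

theorem aemeasurable_formDensity (hKm : Measurable K) {u : Rn n → ℝ} (hu : AEMeasurable u) :
    AEMeasurable (fun z : Rn n × Rn n => ENNReal.ofReal ((u z.1 - u z.2) ^ 2 * K (z.1 - z.2))) := by
  have h1 : AEMeasurable (fun z : Rn n × Rn n => u z.1) :=
    hu.comp_quasiMeasurePreserving Measure.quasiMeasurePreserving_fst
  have h2 : AEMeasurable (fun z : Rn n × Rn n => u z.2) :=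
    hu.comp_quasiMeasurePreserving Measure.quasiMeasurePreserving_snd
  have h3 : Measurable (fun z : Rn n × Rn n => K (z.1 - z.2)) :=
    hKm.comp (measurable_fst.sub measurable_snd)
  exact (((h1.sub h2).pow_const 2).mul h3.aemeasurable).ennreal_ofReal

theorem eLpNorm_ofReal_eq {P : ℝ} (hP : 0 < P) (u : Rn n → ℝ) :
    eLpNorm u (ENNReal.ofReal P) volume =
      (∫⁻ y, ENNReal.ofReal (|u y| ^ P)) ^ (1 / P) := by
  rw [eLpNorm_eq_lintegral_rpow_enorm_toReal (by simpa using hP) ENNReal.ofReal_ne_top,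
    ENNReal.toReal_ofReal hP.le]
  congr 2
  ext y
  rw [← ofReal_norm, ENNReal.ofReal_rpow_of_nonneg (norm_nonneg _) hP.le,
    Real.norm_eq_abs]

/-- The Sobolev inequality for functions already known to be in `L^{2*}`. -/
theorem sobolev_of_finite (hs0 : 0 < s) (hn : 2 * s < n) (hK : IsKernel n s K) {lam : ℝ}
    (hlam : 0 < lam) (hlow : ∀ᵐ x, lam ≤ K x * ‖x‖ ^ ((n : ℝ) + 2 * s))
    {u : Rn n → ℝ} (hu : AEMeasurable u)
    (hfin : ∫⁻ y, ENNReal.ofReal (|u y| ^ critExp n s) ≠ ∞) :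
    eLpNorm u (ENNReal.ofReal (critExp n s)) volume ^ 2 ≤
      ENNReal.ofReal (gagliardoConst n s lam) *
        ∫⁻ z : Rn n × Rn n, ENNReal.ofReal ((u z.1 - u z.2) ^ 2 * K (z.1 - z.2)) := by
  have hP := critExp_gt_two hs0 hn
  have hn0 : (0 : ℝ) < n := by linarith
  have hC := gagliardoConst_pos n s hlam
  rw [eLpNorm_ofReal_eq (by linarith)]
  set A := ∫⁻ y, ENNReal.ofReal (|u y| ^ critExp n s) with hI
  rcases eq_or_ne A 0 with h0 | h0
  · rw [h0, ENNReal.zero_rpow_of_pos (by positivity)]; simp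
  set Q := A.toReal with hQ
  have hQ0 : 0 < Q := ENNReal.toReal_pos h0 hfin
  have hIQ : A = ENNReal.ofReal Q := (ENNReal.ofReal_toReal hfin).symm
  set D := ∫⁻ z : Rn n × Rn n, ENNReal.ofReal ((u z.1 - u z.2) ^ 2 * K (z.1 - z.2)) with hD
  have hDit : D = ∫⁻ x, ∫⁻ y, ENNReal.ofReal ((u x - u y) ^ 2 * K (x - y)) := by
    rw [hD]
    exact lintegral_prod _ (aemeasurable_formDensity hK.measurable hu)
  have key : A ≤ ENNReal.ofReal (gagliardoConst n s lam * Q ^ (2 * s / n)) * D := by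
    rw [hDit, hI, ← lintegral_const_mul' _ _ ENNReal.ofReal_ne_top]
    exact lintegral_mono fun x =>
      rpow_le_mul_lintegral hs0 hn hK hlam hlow hu hQ0 hIQ.le x
  rw [ENNReal.ofReal_mul hC.le, ← ENNReal.ofReal_rpow_of_pos hQ0, ← hIQ] at key
  -- Multiplying A ≤ C A^(2s/n) D by A^(-2s/n) leaves the power 2/P on the left; this needs 0 < A <
  -- ∞.
  have hexp : (A ^ (1 / critExp n s)) ^ 2 = A * A ^ (-(2 * s / n)) := by
    rw [← ENNReal.rpow_natCast, ← ENNReal.rpow_mul]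
    nth_rewrite 2 [← ENNReal.rpow_one A]
    rw [← ENNReal.rpow_add _ _ h0 hfin]
    congr 1
    rw [← sub_eq_add_neg, one_sub_eq_two_div_critExp hs0 hn]
    push_cast; ring
  rw [hexp]
  calc A * A ^ (-(2 * s / n)) ≤
      (ENNReal.ofReal (gagliardoConst n s lam) * A ^ (2 * s / n) * D) * A ^ (-(2 * s / n)) := by gcongr
    _ = ENNReal.ofReal (gagliardoConst n s lam) * D * (A ^ (2 * s / n) * A ^ (-(2 * s / n))) := by ring
    _ = ENNReal.ofReal (gagliardoConst n s lam) * D := by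
      rw [← ENNReal.rpow_add _ _ h0 hfin]; simp

/-- Truncation of a real number to `[-T, T]`. -/
noncomputable def clip (T t : ℝ) : ℝ := max (-T) (min t T)

theorem abs_clip_sub_le (T a b : ℝ) : |clip T a - clip T b| ≤ |a - b| := by
  unfold clip
  exact (abs_max_sub_max_le_max _ _ _ _).trans
    (by simpa using abs_min_sub_min_le_max a T b T)

theorem abs_clip_le {T : ℝ} (hT : 0 ≤ T) (a : ℝ) : |clip T a| ≤ T := by
  unfold clip
  rw [abs_le]
  exact ⟨le_max_left _ _, max_le (by linarith) (min_le_right _ _)⟩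

theorem abs_clip_le_abs {T : ℝ} (hT : 0 ≤ T) (a : ℝ) : |clip T a| ≤ |a| := by
  have h := abs_clip_sub_le T a 0
  have h0 : clip T 0 = 0 := by simp [clip, hT]
  simpa [h0] using h

theorem clip_eq {T a : ℝ} (h : |a| ≤ T) : clip T a = a := by
  rw [abs_le] at h
  simp [clip, h.1, h.2]

/-- Finiteness of the L^P norm is removed by clipping: a clipped L² function is bounded, hence in
L^P. Clipping does not increase differences, so the right side is uniform in the height, and Fatou
passes to the limit. -/
theorem sobolev_lintegral (hs0 : 0 < s) (hn : 2 * s < n) (hK : IsKernel n s K) {lam : ℝ}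
    (hlam : 0 < lam) (hlow : ∀ᵐ x, lam ≤ K x * ‖x‖ ^ ((n : ℝ) + 2 * s))
    {u : Rn n → ℝ} (hu : MemLp u 2 volume) :
    eLpNorm u (ENNReal.ofReal (critExp n s)) volume ^ 2 ≤
      ENNReal.ofReal (gagliardoConst n s lam) *
        ∫⁻ z : Rn n × Rn n, ENNReal.ofReal ((u z.1 - u z.2) ^ 2 * K (z.1 - z.2)) := by
  have hP := critExp_gt_two hs0 hn
  set B := ENNReal.ofReal (gagliardoConst n s lam) *
        ∫⁻ z : Rn n × Rn n, ENNReal.ofReal ((u z.1 - u z.2) ^ 2 * K (z.1 - z.2)) with hB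
  have hum : AEMeasurable u := hu.1.aemeasurable
  have hclipm : ∀ T : ℝ, AEMeasurable (fun x => clip T (u x)) := fun T =>
    aemeasurable_const.max (hum.min aemeasurable_const)
  have htr : ∀ N : ℕ,
      eLpNorm (fun x => clip N (u x)) (ENNReal.ofReal (critExp n s)) volume ≤ B ^ (1 / 2 : ℝ) := by
    intro N
    have hfin : ∫⁻ y, ENNReal.ofReal (|clip N (u y)| ^ critExp n s) ≠ ∞ := by
      have h2 : Integrable (fun y => (N : ℝ) ^ (critExp n s - 2) * u y ^ 2) :=
        ((memLp_two_iff_integrable_sq hu.1).1 hu).const_mul _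
      refine ne_top_of_le_ne_top h2.lintegral_lt_top.ne (lintegral_mono fun y => ?_)
      apply ENNReal.ofReal_le_ofReal
      have hN : (0 : ℝ) ≤ N := by positivity
      rcases (abs_nonneg (clip N (u y))).eq_or_lt with h0 | h0
      · rw [← h0, Real.zero_rpow (by linarith)]; positivity
      · calc |clip N (u y)| ^ critExp n s
            = |clip N (u y)| ^ (critExp n s - 2) * |clip N (u y)| ^ 2 := by
              rw [← Real.rpow_natCast _ 2, ← Real.rpow_add h0]; norm_num
          _ ≤ (N : ℝ) ^ (critExp n s - 2) * |u y| ^ 2 :=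
              mul_le_mul (Real.rpow_le_rpow h0.le (abs_clip_le hN _) (by linarith))
                (pow_le_pow_left₀ h0.le (abs_clip_le_abs hN _) 2) (by positivity) (by positivity)
          _ = _ := by rw [sq_abs]
    have h1 := sobolev_of_finite hs0 hn hK hlam hlow (hclipm N) hfin
    have h2 : eLpNorm (fun x => clip N (u x)) (ENNReal.ofReal (critExp n s)) volume ^ 2 ≤ B := by
      refine h1.trans ?_
      rw [hB]
      refine mul_le_mul_right (lintegral_mono fun z => ENNReal.ofReal_le_ofReal ?_) _
      exact mul_le_mul_of_nonneg_right (sq_le_sq.2 (abs_clip_sub_le _ _ _)) (hK.pos _).le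
    calc _ = (eLpNorm (fun x => clip N (u x)) (ENNReal.ofReal (critExp n s)) volume ^ 2)
          ^ (1 / 2 : ℝ) := by
            rw [← ENNReal.rpow_natCast, ← ENNReal.rpow_mul]; norm_num
      _ ≤ _ := by gcongr
  have hlim := Lp.eLpNorm_lim_le_liminf_eLpNorm (p := ENNReal.ofReal (critExp n s))
    (fun N : ℕ => (hclipm N).aestronglyMeasurable) u (Eventually.of_forall fun x => by
      apply tendsto_const_nhds.congr'
      filter_upwards [eventually_ge_atTop ⌈|u x|⌉₊] with N hN
      exact (clip_eq ((Nat.le_ceil _).trans (by exact_mod_cast hN))).symm)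
  have hle : eLpNorm u (ENNReal.ofReal (critExp n s)) volume ≤ B ^ (1 / 2 : ℝ) :=
    hlim.trans (liminf_le_of_frequently_le' (Frequently.of_forall htr))
  calc _ ≤ (B ^ (1 / 2 : ℝ)) ^ 2 := by gcongr
    _ = B := by rw [← ENNReal.rpow_natCast, ← ENNReal.rpow_mul]; norm_num

/-! ### The bilinear form -/

theorem MemX.aem {u : Rn n → ℝ} (hu : MemX K u) : AEStronglyMeasurable u volume := hu.1.1

theorem MemX.integrable_sq {u : Rn n → ℝ} (hu : MemX K u) : Integrable (fun x => u x ^ 2) :=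
  (memLp_two_iff_integrable_sq hu.1.1).1 hu.1

theorem integrable_form (hKp : ∀ x, 0 < K x) {u v : Rn n → ℝ} (hu : MemX K u) (hv : MemX K v) :
    Integrable (fun z : Rn n × Rn n => (u z.1 - u z.2) * (v z.1 - v z.2) * K (z.1 - z.2)) := by
  refine (hu.2.integrable_mul hv.2).congr (Eventually.of_forall fun z => ?_)
  have := Real.mul_self_sqrt (hKp (z.1 - z.2)).le
  simp only [Pi.mul_apply]
  linear_combination ((u z.1 - u z.2) * (v z.1 - v z.2)) * this

theorem form_self_nonneg (hKp : ∀ x, 0 < K x) (u : Rn n → ℝ) : 0 ≤ form K u u :=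
  integral_nonneg fun _ => mul_nonneg (mul_self_nonneg _) (hKp _).le

theorem sobolev_form (hs0 : 0 < s) (hn : 2 * s < n) (hK : IsKernel n s K) {lam : ℝ}
    (hlam : 0 < lam) (hlow : ∀ᵐ x, lam ≤ K x * ‖x‖ ^ ((n : ℝ) + 2 * s))
    {u : Rn n → ℝ} (hu : MemX K u) :
    eLpNorm u (ENNReal.ofReal (critExp n s)) volume ^ 2 ≤
      ENNReal.ofReal (gagliardoConst n s lam * form K u u) := by
  refine (sobolev_lintegral hs0 hn hK hlam hlow hu.1).trans (le_of_eq ?_)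
  rw [ENNReal.ofReal_mul (gagliardoConst_pos n s hlam).le, form,
    ofReal_integral_eq_lintegral_ofReal (integrable_form hK.pos hu hu)
      (Eventually.of_forall fun z => mul_nonneg (mul_self_nonneg _) (hK.pos _).le)]
  simp only [sq]

/-- Composition with a `1`-Lipschitz function vanishing at `0` preserves `X`. -/
theorem MemX.comp_lipschitz (hKm : Measurable K) {u : Rn n → ℝ} (hu : MemX K u) {φ : ℝ → ℝ}
    (hφ : LipschitzWith 1 φ) (hφ0 : φ 0 = 0) : MemX K (fun x => φ (u x)) := by
  have hlip : ∀ a b, |φ a - φ b| ≤ |a - b| := fun a b => by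
    simpa [Real.dist_eq] using hφ.dist_le_mul a b
  have hm : AEStronglyMeasurable (fun x => φ (u x)) volume :=
    hφ.continuous.comp_aestronglyMeasurable hu.aem
  refine ⟨hu.1.mono hm (Eventually.of_forall fun x => ?_),
    hu.2.mono ?_ (Eventually.of_forall fun z => ?_)⟩
  · simpa [hφ0] using hlip (u x) 0
  · have h1 : AEStronglyMeasurable (fun z : Rn n × Rn n => φ (u z.1)) volume :=
      hm.comp_quasiMeasurePreserving Measure.quasiMeasurePreserving_fst
    have h2 : AEStronglyMeasurable (fun z : Rn n × Rn n => φ (u z.2)) volume :=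
      hm.comp_quasiMeasurePreserving Measure.quasiMeasurePreserving_snd
    have h3 : Measurable (fun z : Rn n × Rn n => √(K (z.1 - z.2))) :=
      (hKm.comp (measurable_fst.sub measurable_snd)).sqrt
    exact (h1.sub h2).mul h3.aestronglyMeasurable
  · simp only [Real.norm_eq_abs, abs_mul]
    exact mul_le_mul_of_nonneg_right (hlip _ _) (abs_nonneg _)

/-! ### De Giorgi iteration -/

/-- The `Lᴾ` norm as a real number. -/
noncomputable def rnorm (P : ℝ) (u : Rn n → ℝ) : ℝ :=
  (eLpNorm u (ENNReal.ofReal P) volume).toReal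

theorem rnorm_eq_integral {P : ℝ} (hP : 0 < P) {u : Rn n → ℝ}
    (hu : MemLp u (ENNReal.ofReal P) volume) :
    rnorm P u = (∫ x, |u x| ^ P) ^ (1 / P) := by
  rw [rnorm, hu.eLpNorm_eq_integral_rpow_norm (by simpa using hP) ENNReal.ofReal_ne_top,
    ENNReal.toReal_ofReal hP.le, ENNReal.toReal_ofReal, one_div]
  · simp
  · positivity

/-- The upper truncation `(t - ℓ)⁺`. -/
noncomputable def excess (ℓ t : ℝ) : ℝ := max (t - ℓ) 0

theorem excess_nonneg (ℓ t : ℝ) : 0 ≤ excess ℓ t := le_max_right _ _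

theorem lipschitz_excess (ℓ : ℝ) : LipschitzWith 1 (excess ℓ) := by
  refine LipschitzWith.of_dist_le_mul fun a b => ?_
  rw [Real.dist_eq, Real.dist_eq, NNReal.coe_one, one_mul]
  refine (abs_max_sub_max_le_max _ _ _ _).trans ?_
  simp

theorem excess_zero {ℓ : ℝ} (hℓ : 0 ≤ ℓ) : excess ℓ 0 = 0 := by simp [excess, hℓ]

theorem excess_le_abs {ℓ : ℝ} (hℓ : 0 ≤ ℓ) (t : ℝ) : excess ℓ t ≤ |t| :=
  max_le (by linarith [le_abs_self t]) (abs_nonneg t)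

theorem excess_anti {ℓ ℓ' : ℝ} (h : ℓ ≤ ℓ') (t : ℝ) : excess ℓ' t ≤ excess ℓ t :=
  max_le_max_right _ (by linarith)

/-- The truncation is nondecreasing and 1-Lipschitz, so its increments have the sign of a - b and no
larger size. Hence testing with the truncation controls its own energy. -/
theorem excess_sub_sq_le (ℓ a b : ℝ) :
    (excess ℓ a - excess ℓ b) * (excess ℓ a - excess ℓ b) ≤
      (a - b) * (excess ℓ a - excess ℓ b) := by
  unfold excess
  rcases le_total (a - ℓ) 0 with h1 | h1 <;> rcases le_total (b - ℓ) 0 with h2 | h2 <;>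
    simp only [h1, h2, max_eq_left, max_eq_right] <;> nlinarith

/-- Only t > ℓ' matters. There t ≤ ℓ'/(ℓ'-ℓ) · (t-ℓ), and the ratio (t-ℓ)/(ℓ'-ℓ) ≥ 1 may be raised
to the power η for free: this creates the superquadratic exponent. -/
theorem excess_product_le {ℓ ℓ' η : ℝ} (h0 : 0 ≤ ℓ) (h : ℓ < ℓ') (hη : 0 < η) (t : ℝ) :
    |t| * excess ℓ' t ≤ ℓ' / (ℓ' - ℓ) * (ℓ' - ℓ) ^ (-η) * excess ℓ t ^ (2 + η) := by
  have hd : 0 < ℓ' - ℓ := by linarith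
  rcases le_or_gt t ℓ' with ht | ht
  · have : excess ℓ' t = 0 := by simp [excess, ht]
    rw [this, mul_zero]
    have := excess_nonneg ℓ t
    have : 0 < ℓ' := by linarith
    positivity
  · have h1 : excess ℓ t = t - ℓ := max_eq_left (by linarith)
    have h2 : excess ℓ' t = t - ℓ' := max_eq_left (by linarith)
    have ht0 : 0 < t - ℓ := by linarith
    rw [h1, h2, abs_of_pos (by linarith), Real.rpow_add ht0, Real.rpow_two, Real.rpow_neg hd.le]
    have h3 : 1 ≤ ((ℓ' - ℓ) ^ η)⁻¹ * (t - ℓ) ^ η := by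
      rw [← div_eq_inv_mul, one_le_div (by positivity)]
      exact Real.rpow_le_rpow hd.le (by linarith) hη.le
    have h4 : t * (t - ℓ') ≤ ℓ' / (ℓ' - ℓ) * (t - ℓ) ^ 2 := by
      rw [div_mul_eq_mul_div, le_div_iff₀ hd]
      nlinarith [mul_nonneg h0 (sub_pos.2 ht).le, mul_pos hd hd, mul_pos ht0 hd,
        mul_nonneg h0 (mul_pos (sub_pos.2 ht) ht0).le, mul_pos (sub_pos.2 ht) hd]
    calc t * (t - ℓ') ≤ ℓ' / (ℓ' - ℓ) * (t - ℓ) ^ 2 * 1 := by rw [mul_one]; exact h4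
      _ ≤ ℓ' / (ℓ' - ℓ) * (t - ℓ) ^ 2 * (((ℓ' - ℓ) ^ η)⁻¹ * (t - ℓ) ^ η) := by
        have : 0 < ℓ' := by linarith
        gcongr
      _ = _ := by ring

/-- The gain of integrability in the iteration. -/
noncomputable def gain (P q : ℝ) : ℝ := P - P / q - 2

theorem critExp_div (hs0 : 0 < s) (hn : 2 * s < n) :
    critExp n s / (critExp n s - 2) = n / (2 * s) := by
  have h2 : (0 : ℝ) < n := by linarith
  have hP := critExp_gt_two hs0 hn
  rw [← critExp_mul hs0 hn]
  field_simp

/-- Positivity of the gain amounts to q > P/(P-2), and P/(P-2) = n/(2s). -/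
theorem gain_pos (hs0 : 0 < s) (hn : 2 * s < n) {q : ℝ} (hq : n / (2 * s) < q) :
    0 < gain (critExp n s) q := by
  have hP := critExp_gt_two hs0 hn
  have hq1 : (1 : ℝ) < n / (2 * s) := by rwa [one_lt_div (by positivity)]
  rw [← critExp_div hs0 hn, div_lt_iff₀ (by linarith)] at hq
  have hq0 : 0 < q := by
    by_contra! h
    nlinarith
  have : critExp n s / q < critExp n s - 2 := by rw [div_lt_iff₀ hq0]; linarith
  unfold gain; linarith

/-- The gain η is defined so that 2 + η = P(1 - 1/q); thus P/(2+η) is the Hölder conjugate of q. -/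
theorem holder_rpow {P q : ℝ} (hP : 2 < P) (hq : 1 < q) (hη : 0 < gain P q)
    {H v : Rn n → ℝ} (hH0 : ∀ x, 0 ≤ H x) (hH : MemLp H (ENNReal.ofReal q) volume)
    (hv0 : ∀ x, 0 ≤ v x) (hv : MemLp v (ENNReal.ofReal P) volume) :
    Integrable (fun x => H x * v x ^ (2 + gain P q)) ∧
      ∫ x, H x * v x ^ (2 + gain P q) ≤ rnorm q H * rnorm P v ^ (2 + gain P q) := by
  set η := gain P q with hηd
  have hq0 : 0 < q := by linarith
  have hηq : 2 + η = P * (1 - 1 / q) := by rw [hηd, gain]; field_simp; ring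
  have hconj : q.HolderConjugate (P / (2 + η)) := by
    rw [Real.holderConjugate_iff]
    refine ⟨hq, ?_⟩
    rw [inv_div, hηq]
    field_simp
    ring
  have hvm : MemLp (fun x => v x ^ (2 + η)) (ENNReal.ofReal (P / (2 + η))) volume := by
    have := hv.norm_rpow_div (ENNReal.ofReal (2 + η))
    rw [← ENNReal.ofReal_div_of_pos (by linarith), ENNReal.toReal_ofReal (by linarith)] at this
    simpa only [Real.norm_eq_abs, abs_of_nonneg (hv0 _)] using this
  have := hconj.ennrealOfReal
  refine ⟨hH.integrable_mul hvm, ?_⟩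
  refine (integral_mul_le_Lp_mul_Lq_of_nonneg hconj (Eventually.of_forall hH0)
    (Eventually.of_forall fun x => Real.rpow_nonneg (hv0 x) _) hH hvm).trans (le_of_eq ?_)
  rw [rnorm_eq_integral hq0 hH, rnorm_eq_integral (by linarith) hv, ← Real.rpow_mul]
  · simp only [abs_of_nonneg (hH0 _), abs_of_nonneg (hv0 _), ← Real.rpow_mul (hv0 _)]
    congr 3
    · ext x; congr 1; field_simp
    · field_simp
  · positivity

/-- A constant in the homogeneous Sobolev inequality. -/
def IsSobolevBound (n : ℕ) (s : ℝ) (K : Rn n → ℝ) (A : ℝ) : Prop :=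
  0 < A ∧ ∀ u : Rn n → ℝ, MemX K u →
    eLpNorm u (ENNReal.ofReal (critExp n s)) volume ^ 2 ≤ ENNReal.ofReal (A * form K u u)

theorem exists_isSobolevBound (hs0 : 0 < s) (hn : 2 * s < n) (hK : IsKernel n s K) :
    ∃ A, IsSobolevBound n s K A := by
  obtain ⟨lam, hlam, hlow⟩ := hK.lower
  exact ⟨_, gagliardoConst_pos n s hlam, fun u hu => sobolev_form hs0 hn hK hlam hlow hu⟩

theorem IsSobolevBound.memLp {A : ℝ} (hA : IsSobolevBound n s K A) {u : Rn n → ℝ}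
    (hu : MemX K u) : MemLp u (ENNReal.ofReal (critExp n s)) volume := by
  refine ⟨hu.aem, ?_⟩
  by_contra! h
  have := hA.2 u hu
  rw [top_le_iff.1 h] at this
  simp at this

theorem IsSobolevBound.rnorm_sq_le (hKp : ∀ x, 0 < K x) {A : ℝ} (hA : IsSobolevBound n s K A)
    {u : Rn n → ℝ} (hu : MemX K u) : rnorm (critExp n s) u ^ 2 ≤ A * form K u u := by
  have h := ENNReal.toReal_mono ENNReal.ofReal_ne_top (hA.2 u hu)
  rwa [ENNReal.toReal_ofReal (mul_nonneg hA.1.le (form_self_nonneg hKp u)),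
    ENNReal.toReal_pow] at h

theorem form_excess_le (hK : IsKernel n s K) {w : Rn n → ℝ} (hw : MemX K w) {ℓ : ℝ}
    (hℓ : 0 ≤ ℓ) :
    form K (fun x => excess ℓ (w x)) (fun x => excess ℓ (w x)) ≤
      form K w (fun x => excess ℓ (w x)) := by
  have hv := hw.comp_lipschitz hK.measurable (lipschitz_excess ℓ) (excess_zero hℓ)
  refine integral_mono (integrable_form hK.pos hv hv) (integrable_form hK.pos hw hv) fun z => ?_
  exact mul_le_mul_of_nonneg_right (excess_sub_sq_le _ _ _) (hK.pos _).le

/-- `w` is a subsolution of `-L_K w ≤ H w` above every nonnegative level. -/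
def IsSubsolution (K H w : Rn n → ℝ) : Prop :=
  ∀ ℓ : ℝ, 0 ≤ ℓ →
    form K w (fun x => excess ℓ (w x)) ≤ ∫ x, H x * (|w x| * excess ℓ (w x))

/-- One De Giorgi step: Sobolev for the higher truncation, the subsolution inequality, then Hölder
on the lower one. The right side carries the power 2+η against 2 on the left. -/
theorem level_step (hs0 : 0 < s) (hn : 2 * s < n) (hK : IsKernel n s K) {A : ℝ}
    (hA : IsSobolevBound n s K A) {q : ℝ} (hq : n / (2 * s) < q) {H w : Rn n → ℝ}
    (hH0 : ∀ x, 0 ≤ H x) (hH : MemLp H (ENNReal.ofReal q) volume) (hw : MemX K w)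
    (hsub : IsSubsolution K H w) {ℓ ℓ' : ℝ} (h0 : 0 ≤ ℓ) (h : ℓ < ℓ') :
    rnorm (critExp n s) (fun x => excess ℓ' (w x)) ^ 2 ≤
      A * (ℓ' / (ℓ' - ℓ) * (ℓ' - ℓ) ^ (-gain (critExp n s) q) *
        (rnorm q H * rnorm (critExp n s) (fun x => excess ℓ (w x)) ^
          (2 + gain (critExp n s) q))) := by
  have hP := critExp_gt_two hs0 hn
  have hη := gain_pos hs0 hn hq
  have hq1 : (1 : ℝ) < n / (2 * s) := by rwa [one_lt_div (by positivity)]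
  have hv := hw.comp_lipschitz hK.measurable (lipschitz_excess ℓ) (excess_zero h0)
  have hv' := hw.comp_lipschitz hK.measurable (lipschitz_excess ℓ')
    (excess_zero (h0.trans h.le))
  obtain ⟨hint, hle⟩ := holder_rpow hP (hq1.trans hq) hη hH0 hH
    (fun x => excess_nonneg ℓ (w x)) (hA.memLp hv)
  have hc : 0 ≤ ℓ' / (ℓ' - ℓ) * (ℓ' - ℓ) ^ (-gain (critExp n s) q) := by
    have : 0 < ℓ' - ℓ := by linarith
    have : 0 < ℓ' := by linarith
    positivity
  refine (hA.rnorm_sq_le hK.pos hv').trans (mul_le_mul_of_nonneg_left ?_ hA.1.le)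
  refine (form_excess_le hK hw (h0.trans h.le)).trans ((hsub ℓ' (h0.trans h.le)).trans ?_)
  refine le_trans ?_ (mul_le_mul_of_nonneg_left hle hc)
  rw [← integral_const_mul]
  refine integral_mono_of_nonneg (Eventually.of_forall fun x => ?_) (hint.const_mul _)
    (Eventually.of_forall fun x => ?_)
  · exact mul_nonneg (hH0 x) (mul_nonneg (abs_nonneg _) (excess_nonneg _ _))
  · calc H x * (|w x| * excess ℓ' (w x)) ≤ H x * _ :=
        mul_le_mul_of_nonneg_left (excess_product_le h0 h hη (w x)) (hH0 x)
      _ = _ := by ring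

/-- The factor in the `L^∞` bound. -/
noncomputable def supFactor (A η r : ℝ) : ℝ :=
  (A * (r + 1) * 2 ^ (1 + η) * 2 ^ (2 * ((1 + η) / η))) ^ (1 / η)

theorem supFactor_pos {A η r : ℝ} (hA : 0 < A) (hr : 0 ≤ r) : 0 < supFactor A η r := by
  unfold supFactor; positivity

theorem monotoneOn_supFactor {A η : ℝ} (hA : 0 < A) (hη : 0 < η) :
    MonotoneOn (supFactor A η) (Ici 0) := by
  intro r hr r' _ h
  have : (0 : ℝ) ≤ r := hr
  unfold supFactor
  gcongr

/-- Fast geometric decay of the truncated norms. -/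
theorem geometric_decay {A η r L α : ℝ} (hA : 0 < A) (hη : 0 < η) (hr : 0 ≤ r) (hα : 0 < α)
    (hL : L = supFactor A η r * α) {b : ℕ → ℝ} (hb0 : ∀ k, 0 ≤ b k) (hb : b 0 ≤ α)
    (hstep : ∀ k, b (k + 1) ^ 2 ≤
      A * (2 ^ (k + 1) * (L * (2 ^ (k + 1))⁻¹) ^ (-η) * (r * b k ^ (2 + η)))) (k : ℕ) :
    b k ≤ α * ((2 : ℝ) ^ (-((1 + η) / η))) ^ k := by
  have hM := supFactor_pos (η := η) hA hr
  -- The factor uses r + 1 rather than r so that it stays positive when the weight vanishes.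
  have hMη : supFactor A η r ^ η = A * (r + 1) * 2 ^ (1 + η) * 2 ^ (2 * ((1 + η) / η)) := by
    unfold supFactor
    rw [← Real.rpow_mul (by positivity), one_div_mul_cancel hη.ne', Real.rpow_one]
  -- The coefficients grow like 2^((1+η)k), and ρ^η 2^(1+η) = 1 absorbs this growth. The last power
  -- of 2 in `supFactor` is ρ^(-2), which pays for the extra ρ gained at each step.
  set ρ : ℝ := (2 : ℝ) ^ (-((1 + η) / η)) with hρ
  have hρ0 : 0 < ρ := by positivity
  have hρη : ρ ^ η * 2 ^ (1 + η) = 1 := by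
    rw [hρ, ← Real.rpow_mul (by norm_num), ← Real.rpow_add (by norm_num)]
    have : -((1 + η) / η) * η + (1 + η) = 0 := by field_simp; ring
    rw [this, Real.rpow_zero]
  have hρ2 : ρ ^ 2 * 2 ^ (2 * ((1 + η) / η)) = 1 := by
    rw [hρ, ← Real.rpow_natCast, ← Real.rpow_mul (by norm_num), ← Real.rpow_add (by norm_num)]
    have : -((1 + η) / η) * (2 : ℕ) + 2 * ((1 + η) / η) = 0 := by push_cast; ring
    rw [this, Real.rpow_zero]
  have hL0 : 0 < L := by rw [hL]; positivity
  induction k with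
  | zero => simpa using hb
  | succ k ih =>
    refine abs_le_of_sq_le_sq' ?_ (by positivity) |>.2
    refine (hstep k).trans ?_
    have e1 : b k ^ (2 + η) ≤ (α * ρ ^ k) ^ (2 + η) :=
      Real.rpow_le_rpow (hb0 k) ih (by linarith)
    have e2 : (α * ρ ^ k) ^ (2 + η) = (α * ρ ^ k) ^ 2 * (α ^ η * (ρ ^ η) ^ k) := by
      rw [Real.rpow_add (by positivity), Real.rpow_two,
        Real.mul_rpow (x := α) (by positivity) (by positivity), Real.rpow_pow_comm hρ0.le]
    have e3 : (L * (2 ^ (k + 1))⁻¹) ^ (-η) =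
        (supFactor A η r ^ η)⁻¹ * (α ^ η)⁻¹ * ((2 : ℝ) ^ η) ^ (k + 1) := by
      rw [hL, Real.rpow_neg (by positivity), Real.mul_rpow (by positivity) (by positivity),
        Real.mul_rpow hM.le hα.le, Real.inv_rpow (by positivity), mul_inv, mul_inv, inv_inv,
        Real.rpow_pow_comm (by norm_num)]
    have e4 : (2 : ℝ) ^ (1 + η) = 2 * 2 ^ η := by
      rw [Real.rpow_add (by norm_num), Real.rpow_one]
    calc A * (2 ^ (k + 1) * (L * (2 ^ (k + 1))⁻¹) ^ (-η) * (r * b k ^ (2 + η)))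
        ≤ A * (2 ^ (k + 1) * (L * (2 ^ (k + 1))⁻¹) ^ (-η) *
            ((r + 1) * (α * ρ ^ k) ^ (2 + η))) := by
          have := Real.rpow_nonneg (hb0 k) (2 + η)
          gcongr
          linarith
      _ = (α * ρ ^ k) ^ 2 * (A * (r + 1) * (2 ^ (1 + η)) ^ (k + 1) * (ρ ^ η) ^ k *
            (supFactor A η r ^ η)⁻¹) := by
          rw [e2, e3, e4, mul_pow]
          have : α ^ η ≠ 0 := by positivity
          field_simp
          ring
      _ = (α * ρ ^ k) ^ 2 * (A * (r + 1) * 2 ^ (1 + η) *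
            (supFactor A η r ^ η)⁻¹) * (ρ ^ η * 2 ^ (1 + η)) ^ k := by ring
      _ = (α * ρ ^ k) ^ 2 * ρ ^ 2 := by
          rw [hρη, one_pow, mul_one, hMη]
          congr 1
          rw [← div_eq_mul_inv, div_eq_iff (by positivity)]
          linear_combination (-(A * (r + 1) * 2 ^ (1 + η))) * hρ2
      _ = (α * ρ ^ (k + 1)) ^ 2 := by ring

/-- Subsolutions are bounded above. -/
theorem IsSubsolution.le (hs0 : 0 < s) (hn : 2 * s < n) (hK : IsKernel n s K) {A : ℝ}
    (hA : IsSobolevBound n s K A) {q : ℝ} (hq : n / (2 * s) < q) {H w : Rn n → ℝ}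
    (hH0 : ∀ x, 0 ≤ H x) (hH : MemLp H (ENNReal.ofReal q) volume) (hw : MemX K w)
    (hsub : IsSubsolution K H w) :
    ∀ᵐ x, w x ≤ supFactor A (gain (critExp n s) q) (rnorm q H) * rnorm (critExp n s) w := by
  have hP := critExp_gt_two hs0 hn
  have hPne : ENNReal.ofReal (critExp n s) ≠ 0 := by simp; linarith
  have hη := gain_pos hs0 hn hq
  set η := gain (critExp n s) q with hηd
  set P := critExp n s with hPd
  set r := rnorm q H with hr
  have hr0 : 0 ≤ r := ENNReal.toReal_nonneg
  have hwP := hA.memLp hw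
  set α := rnorm P w with hα
  have hα0 : 0 ≤ α := ENNReal.toReal_nonneg
  -- If ‖w‖_P = 0 the levels below would all coincide, so this case is separate; w then vanishes
  -- a.e.
  rcases hα0.eq_or_lt with h0 | hαpos
  · have : eLpNorm w (ENNReal.ofReal P) volume = 0 := by
      rcases (ENNReal.toReal_eq_zero_iff _).1 h0.symm with h | h
      · exact h
      · exact absurd h hwP.2.ne
    filter_upwards [(eLpNorm_eq_zero_iff hw.aem hPne).1 this] with x hx
    rw [← h0, hx]; simp
  have hMpos := supFactor_pos (η := η) hA.1 hr0
  set L := supFactor A η r * α with hL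
  have hLpos : 0 < L := by positivity
  -- Levels rise from 0 to L with gaps L/2^(k+1), so the ratio ℓ'/(ℓ'-ℓ) is at most 2^(k+1).
  set lev : ℕ → ℝ := fun k => L * (1 - ((2 : ℝ) ^ k)⁻¹) with hlev
  have hlev0 : ∀ k, 0 ≤ lev k := fun k => by
    have : ((2 : ℝ) ^ k)⁻¹ ≤ 1 := inv_le_one_of_one_le₀ (one_le_pow₀ (by norm_num))
    exact mul_nonneg hLpos.le (by linarith)
  have hlevL : ∀ k, lev k ≤ L := fun k => by
    have : 0 < ((2 : ℝ) ^ k)⁻¹ := by positivity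
    simp only [hlev]
    nlinarith
  have hdiff : ∀ k, lev (k + 1) - lev k = L * (2 ^ (k + 1))⁻¹ := fun k => by
    simp only [hlev, pow_succ, mul_inv]; ring
  set b : ℕ → ℝ := fun k => rnorm P (fun x => excess (lev k) (w x)) with hbd
  have hmem : ∀ ℓ, 0 ≤ ℓ → MemLp (fun x => excess ℓ (w x)) (ENNReal.ofReal P) volume :=
    fun ℓ hℓ => hA.memLp (hw.comp_lipschitz hK.measurable (lipschitz_excess ℓ) (excess_zero hℓ))
  have hdecay := geometric_decay hA.1 hη hr0 hαpos hL (b := b)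
    (fun k => ENNReal.toReal_nonneg)
    (ENNReal.toReal_mono hwP.2.ne (eLpNorm_mono fun x => by
      rw [Real.norm_eq_abs, Real.norm_eq_abs, abs_of_nonneg (excess_nonneg _ _)]
      exact excess_le_abs (hlev0 0) _))
    (fun k => by
      have hlt : lev k < lev (k + 1) := by
        have := hdiff k
        have : 0 < L * ((2 : ℝ) ^ (k + 1))⁻¹ := by positivity
        linarith
      have h1 := level_step hs0 hn hK hA hq hH0 hH hw hsub (hlev0 k) hlt
      rw [hdiff k] at h1
      refine h1.trans (mul_le_mul_of_nonneg_left ?_ hA.1.le)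
      have hfrac : lev (k + 1) / (L * (2 ^ (k + 1))⁻¹) ≤ 2 ^ (k + 1) := by
        rw [div_le_iff₀ (by positivity)]
        refine (hlevL _).trans (le_of_eq ?_)
        field_simp
      have hb0 : 0 ≤ b k := ENNReal.toReal_nonneg
      gcongr)
  have hzero : rnorm P (fun x => excess L (w x)) ≤ 0 := by
    have hlim : Tendsto (fun k : ℕ => α * ((2 : ℝ) ^ (-((1 + η) / η))) ^ k) atTop (𝓝 (α * 0)) := by
      refine (tendsto_pow_atTop_nhds_zero_of_lt_one (by positivity) ?_).const_mul α
      refine Real.rpow_lt_one_of_one_lt_of_neg (by norm_num) ?_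
      have : 0 < (1 + η) / η := by positivity
      linarith
    rw [mul_zero] at hlim
    refine ge_of_tendsto' hlim fun k => le_trans ?_ (hdecay k)
    refine ENNReal.toReal_mono (hmem _ (hlev0 k)).2.ne (eLpNorm_mono fun x => ?_)
    rw [Real.norm_eq_abs, Real.norm_eq_abs, abs_of_nonneg (excess_nonneg _ _),
      abs_of_nonneg (excess_nonneg _ _)]
    exact excess_anti (hlevL k) _
  have hz : eLpNorm (fun x => excess L (w x)) (ENNReal.ofReal P) volume = 0 := by
    rcases (ENNReal.toReal_eq_zero_iff _).1 (le_antisymm hzero ENNReal.toReal_nonneg) with h | h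
    · exact h
    · exact absurd h (hmem L hLpos.le).2.ne
  filter_upwards [(eLpNorm_eq_zero_iff (hmem L hLpos.le).1 hPne).1 hz] with x hx
  have : w x - L ≤ excess L (w x) := le_max_left _ _
  rw [hx] at this
  simp only [Pi.zero_apply] at this
  linarith

/-! ### The truncated nonlinearity -/

section Nonlinearity

variable {p c₀ θ Vinf R : ℝ} {f : ℝ → ℝ} {V : Rn n → ℝ}

theorem IsPotential.pos (hV : IsPotential V Vinf) (x : Rn n) : 0 < V x := by
  obtain ⟨δ, hδ, h⟩ := hV.lower
  exact hδ.trans_le (h x)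

theorem two_lt_kConst (hθ : 2 < θ) : 2 < kConst θ := by
  unfold kConst
  rw [lt_div_iff₀ (by linarith)]
  linarith

theorem IsNonlinearity.eq_zero (hf : IsNonlinearity n s p c₀ θ f) {t : ℝ} (ht : t ≤ 0) :
    f t = 0 := by
  rcases ht.eq_or_lt with rfl | ht
  · have h := hf.growth 0
    have hp := hf.two_lt_p
    rw [abs_zero, Real.zero_rpow (by linarith), mul_zero] at h
    exact abs_nonpos_iff.1 h
  · exact hf.zero t ht

theorem IsNonlinearity.nonneg (hf : IsNonlinearity n s p c₀ θ f) (t : ℝ) : 0 ≤ f t := by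
  rcases le_or_gt t 0 with ht | ht
  · exact (hf.eq_zero ht).ge
  · exact (hf.pos t ht).le

theorem IsNonlinearity.c₀_pos (hf : IsNonlinearity n s p c₀ θ f) : 0 < c₀ := by
  have h := hf.growth 1
  rw [abs_one, Real.one_rpow, mul_one] at h
  exact (hf.pos 1 one_pos).trans_le ((le_abs_self _).trans h)

theorem IsNonlinearity.le_mul_abs (hf : IsNonlinearity n s p c₀ θ f) (t : ℝ) :
    f t ≤ c₀ * |t| ^ (p - 2) * |t| := by
  refine (le_abs_self _).trans ((hf.growth t).trans (le_of_eq ?_))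
  have hp := hf.two_lt_p
  rw [mul_assoc, ← Real.rpow_add_one' (abs_nonneg t) (by linarith)]
  congr 2; ring

/-- Valid for t of either sign. The minimum form makes continuity, measurability and both one-sided
bounds immediate. -/
theorem fTrunc_eq_min (hθ : 2 < θ) (x : Rn n) (t : ℝ) :
    fTrunc V θ f x t = min (f t) (V x / kConst θ * t) := by
  have hk : 0 < kConst θ := by linarith [two_lt_kConst hθ]
  have key : kConst θ * f t ≤ V x * t ↔ f t ≤ V x / kConst θ * t := by
    rw [div_mul_eq_mul_div, le_div_iff₀ hk, mul_comm]
  unfold fTrunc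
  split_ifs with h
  · rw [min_eq_left (key.1 h)]
  · rw [min_eq_right (le_of_not_ge fun h' => h (key.2 h'))]

theorem gAux_le (hθ : 2 < θ) (x : Rn n) (t : ℝ) : gAux V θ R f x t ≤ f t := by
  unfold gAux
  split_ifs
  · exact le_rfl
  · rw [fTrunc_eq_min hθ]; exact min_le_left _ _

theorem gAux_nonneg (hf : IsNonlinearity n s p c₀ θ f) (hV : IsPotential V Vinf) (x : Rn n)
    {t : ℝ} (ht : 0 ≤ t) : 0 ≤ gAux V θ R f x t := by
  have hk : 0 < kConst θ := by linarith [two_lt_kConst hf.two_lt_θ]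
  have := hV.pos x
  unfold gAux
  split_ifs
  · exact hf.nonneg t
  · rw [fTrunc_eq_min hf.two_lt_θ]; exact le_min (hf.nonneg t) (by positivity)

theorem gAux_nonpos (hf : IsNonlinearity n s p c₀ θ f) (x : Rn n)
    {t : ℝ} (ht : t ≤ 0) : gAux V θ R f x t ≤ 0 :=
  (gAux_le hf.two_lt_θ x t).trans (hf.eq_zero ht).le

/-- For t < 0 outside the ball of radius R the truncation equals V t/k, not 0; since k > 1 and V t ≤
0, it still dominates V t. -/
theorem le_gAux_of_nonpos (hf : IsNonlinearity n s p c₀ θ f) (hV : IsPotential V Vinf)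
    (x : Rn n) {t : ℝ} (ht : t ≤ 0) : V x * t ≤ gAux V θ R f x t := by
  have hk := two_lt_kConst hf.two_lt_θ
  have hVx := hV.pos x
  have h0 : V x * t ≤ 0 := mul_nonpos_of_nonneg_of_nonpos hVx.le ht
  unfold gAux
  split_ifs
  · rw [hf.eq_zero ht]; exact h0
  · rw [fTrunc_eq_min hf.two_lt_θ, hf.eq_zero ht]
    refine le_min h0 ?_
    rw [div_mul_eq_mul_div, le_div_iff₀ (by linarith)]
    nlinarith

theorem abs_gAux_le (hf : IsNonlinearity n s p c₀ θ f) (hV : IsPotential V Vinf)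
    (x : Rn n) (t : ℝ) :
    |gAux V θ R f x t| ≤ c₀ * |t| ^ (p - 2) * |t| + V x * |t| := by
  have h1 : 0 ≤ c₀ * |t| ^ (p - 2) * |t| := by have := hf.c₀_pos; positivity
  have h2 : 0 ≤ V x * |t| := by have := hV.pos x; positivity
  rcases le_total 0 t with ht | ht
  · rw [abs_of_nonneg (gAux_nonneg hf hV x ht)]
    linarith [gAux_le (R := R) (V := V) (f := f) hf.two_lt_θ x t, hf.le_mul_abs t]
  · rw [abs_of_nonpos (gAux_nonpos hf x ht)]
    have := le_gAux_of_nonpos (R := R) hf hV x ht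
    have h3 : V x * |t| = -(V x * t) := by rw [abs_of_nonpos ht]; ring
    linarith

theorem gAux_mul_nonneg (hf : IsNonlinearity n s p c₀ θ f) (hV : IsPotential V Vinf)
    (x : Rn n) (t : ℝ) : 0 ≤ gAux V θ R f x t * t := by
  rcases le_total 0 t with ht | ht
  · exact mul_nonneg (gAux_nonneg hf hV x ht) ht
  · exact mul_nonneg_of_nonpos_of_nonpos (gAux_nonpos hf x ht) ht

theorem continuous_gAux (hf : IsNonlinearity n s p c₀ θ f) (x : Rn n) :
    Continuous (gAux V θ R f x) := by
  by_cases h : ‖x‖ ≤ R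
  · have : gAux V θ R f x = f := by ext t; simp [gAux, h]
    rw [this]; exact hf.continuous
  · have : gAux V θ R f x = fun t => min (f t) (V x / kConst θ * t) := by
      ext t; simp [gAux, h, fTrunc_eq_min hf.two_lt_θ]
    rw [this]; exact hf.continuous.min (continuous_const.mul continuous_id)

theorem measurable_uncurry_gAux (hf : IsNonlinearity n s p c₀ θ f) (hV : IsPotential V Vinf) :
    Measurable (Function.uncurry (gAux V θ R f)) := by
  have h1 : Measurable fun z : Rn n × ℝ => f z.2 := hf.continuous.measurable.comp measurable_snd
  have h2 : Measurable fun z : Rn n × ℝ => V z.1 / kConst θ * z.2 :=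
    ((hV.continuous.measurable.comp measurable_fst).div_const _).mul measurable_snd
  have h3 : Function.uncurry (gAux V θ R f) =
      open Classical in
      {z : Rn n × ℝ | ‖z.1‖ ≤ R}.piecewise (fun z => f z.2)
        (fun z => min (f z.2) (V z.1 / kConst θ * z.2)) := by
    ext z
    simp only [Function.uncurry, gAux, fTrunc_eq_min hf.two_lt_θ, piecewise, mem_ofPred_eq]
  rw [h3]
  exact Measurable.piecewise (measurableSet_le measurable_fst.norm measurable_const) h1 (h1.min h2)

theorem aemeasurable_gAux (hf : IsNonlinearity n s p c₀ θ f) (hV : IsPotential V Vinf)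
    {u : Rn n → ℝ} (hu : AEMeasurable u) : AEMeasurable (fun x => gAux V θ R f x (u x)) := by
  refine ⟨fun x => gAux V θ R f x (hu.mk u x), ?_, ?_⟩
  · have h : Measurable fun x : Rn n => (x, hu.mk u x) := measurable_id.prodMk hu.measurable_mk
    have h' := (measurable_uncurry_gAux (R := R) hf hV).comp h
    exact h'
  · filter_upwards [hu.ae_eq_mk] with x hx
    rw [← hx]

theorem primitive_nonneg_of_sign {g : ℝ → ℝ} (h1 : ∀ t, 0 ≤ t → 0 ≤ g t)
    (h2 : ∀ t, t ≤ 0 → g t ≤ 0) (t : ℝ) : 0 ≤ primitive g t := by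
  unfold primitive
  rcases le_total 0 t with ht | ht
  · exact intervalIntegral.integral_nonneg ht fun τ hτ => h1 τ hτ.1
  · rw [intervalIntegral.integral_symm, ← intervalIntegral.integral_neg]
    exact intervalIntegral.integral_nonneg ht fun τ hτ => by linarith [h2 τ hτ.2]

theorem primitive_le_of_abs_le {g : ℝ → ℝ} (hg : Continuous g) {a : ℝ}
    (h1 : ∀ t, 0 ≤ t → g t ≤ a * t) (h2 : ∀ t, t ≤ 0 → a * t ≤ g t) (t : ℝ) :
    primitive g t ≤ a * t ^ 2 / 2 := by
  have hint : ∀ b c : ℝ, ∫ τ in b..c, a * τ = a * (c ^ 2 - b ^ 2) / 2 := fun b c => by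
    rw [intervalIntegral.integral_const_mul, integral_id]; ring
  have hi : ∀ b c : ℝ, IntervalIntegrable (fun τ => a * τ) volume b c := fun b c =>
    (continuous_const.mul continuous_id).intervalIntegrable b c
  unfold primitive
  rcases le_total 0 t with ht | ht
  · have := intervalIntegral.integral_mono_on ht (hg.intervalIntegrable 0 t) (hi 0 t)
      fun τ hτ => h1 τ hτ.1
    rw [hint] at this
    linarith
  · have := intervalIntegral.integral_mono_on ht (hi t 0) (hg.intervalIntegrable t 0)
      fun τ hτ => h2 τ hτ.2
    rw [hint] at this
    rw [intervalIntegral.integral_symm]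
    linarith

theorem IsNonlinearity.primitive_le (hf : IsNonlinearity n s p c₀ θ f) (t : ℝ) :
    primitive f t ≤ 1 / θ * (f t * t) := by
  have hθ := hf.two_lt_θ
  rcases le_or_gt t 0 with ht | ht
  · have : primitive f t = 0 := by
      unfold primitive
      rw [intervalIntegral.integral_symm, neg_eq_zero]
      refine (intervalIntegral.integral_congr fun τ hτ => ?_).trans
        intervalIntegral.integral_zero
      rw [uIcc_of_le ht] at hτ
      exact hf.eq_zero hτ.2
    rw [this, hf.eq_zero ht]; simp
  · have := hf.superquadratic t ht
    rw [one_div, ← div_eq_inv_mul, le_div_iff₀ (by linarith)]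
    linarith

theorem primitive_gAux_nonneg (hf : IsNonlinearity n s p c₀ θ f) (hV : IsPotential V Vinf)
    (x : Rn n) (t : ℝ) : 0 ≤ primitive (gAux V θ R f x) t :=
  primitive_nonneg_of_sign (fun _ h => gAux_nonneg hf hV x h) (fun _ h => gAux_nonpos hf x h) t

/-- For |x| ≤ R superquadraticity gives the first term; elsewhere g lies between 0 and V t/k, which
integrates to the second. Both terms are nonnegative, so their sum covers both regions. -/
theorem primitive_gAux_le (hf : IsNonlinearity n s p c₀ θ f) (hV : IsPotential V Vinf)
    (x : Rn n) (t : ℝ) :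
    primitive (gAux V θ R f x) t ≤
      1 / θ * (gAux V θ R f x t * t) + 1 / (2 * kConst θ) * (V x * t ^ 2) := by
  have hk := two_lt_kConst hf.two_lt_θ
  have hθ := hf.two_lt_θ
  have hVx := hV.pos x
  have h1 : 0 ≤ 1 / (2 * kConst θ) * (V x * t ^ 2) := by positivity
  have h2 : 0 ≤ 1 / θ * (gAux V θ R f x t * t) :=
    mul_nonneg (by positivity) (gAux_mul_nonneg hf hV x t)
  by_cases hx : ‖x‖ ≤ R
  · have : gAux V θ R f x = f := by ext t; simp [gAux, hx]
    rw [this]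
    linarith [hf.primitive_le t]
  · have hg : ∀ t, gAux V θ R f x t = min (f t) (V x / kConst θ * t) := fun t => by
      simp [gAux, hx, fTrunc_eq_min hf.two_lt_θ]
    have := primitive_le_of_abs_le (continuous_gAux (V := V) (R := R) hf x)
      (a := V x / kConst θ) (fun t _ => by rw [hg]; exact min_le_right _ _)
      (fun t ht => by
        rw [hg, hf.eq_zero ht]
        exact le_min (mul_nonpos_of_nonneg_of_nonpos (by positivity) ht) le_rfl) t
    have h3 : V x / kConst θ * t ^ 2 / 2 = 1 / (2 * kConst θ) * (V x * t ^ 2) := by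
      field_simp
    linarith

/-! ### Integrability -/

theorem MemE.comp_lipschitz (hKm : Measurable K) (hV : IsPotential V Vinf) {u : Rn n → ℝ}
    (hu : MemE K V u) {φ : ℝ → ℝ} (hφ : LipschitzWith 1 φ) (hφ0 : φ 0 = 0) :
    MemE K V (fun x => φ (u x)) := by
  have h1 := hu.1.comp_lipschitz hKm hφ hφ0
  refine ⟨h1, hu.2.mono (hV.continuous.aestronglyMeasurable.mul (h1.aem.pow 2))
    (Eventually.of_forall fun x => ?_)⟩
  have hVx := hV.pos x
  have h2 : |φ (u x)| ≤ |u x| := by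
    simpa [Real.dist_eq, hφ0] using hφ.dist_le_mul (u x) 0
  rw [Real.norm_of_nonneg (by positivity), Real.norm_of_nonneg (by positivity)]
  exact mul_le_mul_of_nonneg_left (sq_le_sq.2 h2) hVx.le

/-- Pointwise, |u|^p ≤ |u|² + |u|^P, according to whether |u| ≤ 1 or not. -/
theorem integrable_rpow (hA : ∃ A, IsSobolevBound n s K A) (hp : 2 < p) (hpP : p < critExp n s)
    {u : Rn n → ℝ} (hu : MemX K u) : Integrable (fun x => |u x| ^ p) := by
  obtain ⟨A, hA⟩ := hA
  have h1 := hu.integrable_sq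
  have h2 := (hA.memLp hu).integrable_norm_rpow (by simp; linarith) ENNReal.ofReal_ne_top
  rw [ENNReal.toReal_ofReal (by linarith)] at h2
  refine (h1.add h2).mono ((hu.aem.norm.aemeasurable.pow_const p).aestronglyMeasurable)
    (Eventually.of_forall fun x => ?_)
  have ha := abs_nonneg (u x)
  rw [Real.norm_of_nonneg (by positivity)]
  refine le_trans ?_ (le_abs_self _)
  simp only [Pi.add_apply, Real.norm_eq_abs]
  have h3 : 0 ≤ |u x| ^ critExp n s := by positivity
  rcases le_total |u x| 1 with h | h
  · have : |u x| ^ p ≤ |u x| ^ (2 : ℝ) :=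
      Real.rpow_le_rpow_of_exponent_ge' ha h (by norm_num) hp.le
    rw [Real.rpow_two, sq_abs] at this
    linarith
  · have : |u x| ^ p ≤ |u x| ^ critExp n s := Real.rpow_le_rpow_of_exponent_le h hpP.le
    nlinarith [sq_nonneg (u x)]

theorem integrable_growth (hA : ∃ A, IsSobolevBound n s K A)
    (hf : IsNonlinearity n s p c₀ θ f) {u v : Rn n → ℝ} (hu : MemX K u)
    (hv : AEStronglyMeasurable v volume) (huv : ∀ x, |v x| ≤ |u x|) :
    Integrable (fun x => c₀ * |u x| ^ (p - 2) * (|u x| * v x)) := by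
  have hp := hf.two_lt_p
  have hc := hf.c₀_pos
  have h1 : AEStronglyMeasurable (fun x => |u x|) volume := hu.aem.norm
  refine ((integrable_rpow hA hp hf.p_lt hu).const_mul c₀).mono
    (((h1.aemeasurable.pow_const (p - 2)).aestronglyMeasurable.const_mul c₀).mul (h1.mul hv))
    (Eventually.of_forall fun x => ?_)
  have ha := abs_nonneg (u x)
  have hc2 : 0 ≤ c₀ * |u x| ^ (p - 2) := by positivity
  rw [norm_mul (_ * _), norm_mul |u x|, Real.norm_of_nonneg hc2, Real.norm_of_nonneg ha, Real.norm_eq_abs,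
    Real.norm_of_nonneg (by positivity)]
  have e : |u x| ^ p = |u x| ^ (p - 2) * (|u x| * |u x|) := by
    rw [← mul_assoc, ← Real.rpow_add_one' ha (by linarith), ← Real.rpow_add_one' ha (by linarith)]
    congr 1; ring
  rw [e, ← mul_assoc c₀]
  exact mul_le_mul_of_nonneg_left (mul_le_mul_of_nonneg_left (huv x) ha) hc2

theorem integrable_potential (hV : IsPotential V Vinf) {u v : Rn n → ℝ} (hu : MemE K V u)
    (hv : AEStronglyMeasurable v volume) (huv : ∀ x, |v x| ≤ |u x|) :
    Integrable (fun x => V x * u x * v x) := by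
  refine hu.2.mono ((hV.continuous.aestronglyMeasurable.mul hu.1.aem).mul hv)
    (Eventually.of_forall fun x => ?_)
  have hVx := hV.pos x
  rw [Real.norm_of_nonneg (r := V x * u x ^ 2) (by positivity), norm_mul, norm_mul,
    Real.norm_of_nonneg hVx.le, Real.norm_eq_abs, Real.norm_eq_abs, mul_assoc, ← sq_abs, sq]
  exact mul_le_mul_of_nonneg_left (mul_le_mul_of_nonneg_left (huv x) (abs_nonneg _)) hVx.le

theorem integrable_gAux (hA : ∃ A, IsSobolevBound n s K A)
    (hf : IsNonlinearity n s p c₀ θ f) (hV : IsPotential V Vinf) {u v : Rn n → ℝ}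
    (hu : MemE K V u) (hv : AEStronglyMeasurable v volume) (huv : ∀ x, |v x| ≤ |u x|) :
    Integrable (fun x => gAux V θ R f x (u x) * v x) := by
  refine ((integrable_growth hA hf hu.1 hv huv).norm.add
    (integrable_potential hV hu hv huv).norm).mono
    ((aemeasurable_gAux hf hV hu.1.aem.aemeasurable).aestronglyMeasurable.mul hv)
    (Eventually.of_forall fun x => ?_)
  have hVx := hV.pos x
  have hc := hf.c₀_pos
  refine le_trans ?_ (le_abs_self _)
  have e1 : ‖c₀ * |u x| ^ (p - 2) * (|u x| * v x)‖ = c₀ * |u x| ^ (p - 2) * |u x| * |v x| := by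
    have hc2 : 0 ≤ c₀ * |u x| ^ (p - 2) := by positivity
    rw [norm_mul (_ * _), norm_mul |u x|, Real.norm_of_nonneg hc2, Real.norm_of_nonneg (abs_nonneg _),
      Real.norm_eq_abs, mul_assoc (c₀ * _)]
  have e2 : ‖V x * u x * v x‖ = V x * |u x| * |v x| := by
    rw [norm_mul, norm_mul, Real.norm_of_nonneg hVx.le, Real.norm_eq_abs, Real.norm_eq_abs]
  simp only [Pi.add_apply]
  rw [e1, e2, norm_mul, Real.norm_eq_abs, Real.norm_eq_abs, ← add_mul]
  exact mul_le_mul_of_nonneg_right (abs_gAux_le hf hV x _) (abs_nonneg _)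

/-! ### Solutions are subsolutions of a linear problem -/

theorem form_neg_left (u v : Rn n → ℝ) : form K (fun x => -u x) v = -form K u v := by
  unfold form
  rw [← integral_neg]
  congr 1; ext z; ring

theorem MemX.neg (hKm : Measurable K) {u : Rn n → ℝ} (hu : MemX K u) :
    MemX K (fun x => -u x) :=
  hu.comp_lipschitz hKm (φ := fun t => -t)
    (LipschitzWith.of_dist_le_mul fun a b => by simp [dist_neg_neg]) neg_zero

/-- Tested with (u-ℓ)⁺, which lives where u > 0: the potential term is nonnegative there and can be
dropped, while g ≤ f ≤ c₀|u|^(p-2)|u|. -/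
theorem IsAuxSolution.isSubsolution (hs0 : 0 < s) (hn : 2 * s < n) (hK : IsKernel n s K)
    (hf : IsNonlinearity n s p c₀ θ f) (hV : IsPotential V Vinf) {u : Rn n → ℝ}
    (hu : IsAuxSolution K V θ R f u) : IsSubsolution K (fun x => c₀ * |u x| ^ (p - 2)) u := by
  intro ℓ hℓ
  have hA := exists_isSobolevBound hs0 hn hK
  have hc := hf.c₀_pos
  have hv := hu.1.comp_lipschitz hK.measurable hV (lipschitz_excess ℓ) (excess_zero hℓ)
  have huv : ∀ x, |excess ℓ (u x)| ≤ |u x| := fun x => by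
    rw [abs_of_nonneg (excess_nonneg _ _)]; exact excess_le_abs hℓ _
  have h1 := integrable_growth hA hf hu.1.1 hv.1.aem huv
  have h2 := integrable_potential hV hu.1 hv.1.aem huv
  have h3 := integrable_gAux (R := R) hA hf hV hu.1 hv.1.aem huv
  have h4 := hu.2 _ hv
  have h5 := integral_mono h3 (h2.add h1) fun x => by
    simp only [Pi.add_apply]
    rcases le_total (u x) 0 with ht | ht
    · have : excess ℓ (u x) = 0 := max_eq_right (by linarith)
      simp [this]
    · have hg := (gAux_le (R := R) (V := V) (f := f) hf.two_lt_θ x (u x)).trans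
        (hf.le_mul_abs (u x))
      have he := excess_nonneg ℓ (u x)
      have h6 : 0 ≤ V x * u x * excess ℓ (u x) := by have := hV.pos x; positivity
      have := mul_le_mul_of_nonneg_right hg he
      linarith
  rw [integral_add' h2 h1] at h5
  linarith

/-- No sign of u is assumed. Where u ≤ 0 one has V u ≤ g, so the form of -u against its truncation
is already nonpositive. -/
theorem IsAuxSolution.isSubsolution_neg (hs0 : 0 < s) (hn : 2 * s < n) (hK : IsKernel n s K)
    (hf : IsNonlinearity n s p c₀ θ f) (hV : IsPotential V Vinf) {u : Rn n → ℝ}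
    (hu : IsAuxSolution K V θ R f u) :
    IsSubsolution K (fun x => c₀ * |u x| ^ (p - 2)) (fun x => -u x) := by
  intro ℓ hℓ
  have hA := exists_isSobolevBound hs0 hn hK
  have hc := hf.c₀_pos
  have hv := hu.1.comp_lipschitz hK.measurable hV (φ := fun t => excess ℓ (-t))
    (LipschitzWith.of_dist_le_mul fun a b => by
      simpa [dist_neg_neg] using (lipschitz_excess ℓ).dist_le_mul (-a) (-b))
    (by simpa using excess_zero hℓ)
  have huv : ∀ x, |excess ℓ (-u x)| ≤ |u x| := fun x => by
    rw [abs_of_nonneg (excess_nonneg _ _), ← abs_neg]; exact excess_le_abs hℓ _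
  have h2 := integrable_potential hV hu.1 hv.1.aem huv
  have h3 := integrable_gAux (R := R) hA hf hV hu.1 hv.1.aem huv
  have h4 := hu.2 _ hv
  have h5 := integral_mono h2 h3 fun x => by
    rcases le_total 0 (u x) with ht | ht
    · have : excess ℓ (-u x) = 0 := max_eq_right (by linarith)
      simp [this]
    · exact mul_le_mul_of_nonneg_right (le_gAux_of_nonpos hf hV x ht) (excess_nonneg _ _)
  have h6 : 0 ≤ ∫ x, c₀ * |u x| ^ (p - 2) * (|-u x| * excess ℓ (-u x)) :=
    integral_nonneg fun x => by have := excess_nonneg ℓ (-u x); positivity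
  rw [form_neg_left]
  linarith

/-! ### The energy estimate -/

theorem integral_potential_nonneg (hV : IsPotential V Vinf) (u : Rn n → ℝ) :
    0 ≤ ∫ x, V x * u x ^ 2 :=
  integral_nonneg fun x => mul_nonneg (hV.pos x).le (sq_nonneg _)

theorem normE_sq (hKp : ∀ x, 0 < K x) (hV : IsPotential V Vinf) (u : Rn n → ℝ) :
    normE K V u ^ 2 = form K u u + ∫ x, V x * u x ^ 2 :=
  Real.sq_sqrt (add_nonneg (form_self_nonneg hKp u) (integral_potential_nonneg hV u))

theorem IsAuxSolution.normE_sq_le (hs0 : 0 < s) (hn : 2 * s < n) (hK : IsKernel n s K)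
    (hf : IsNonlinearity n s p c₀ θ f) (hV : IsPotential V Vinf) {u : Rn n → ℝ}
    (hu : IsAuxSolution K V θ R f u) :
    normE K V u ^ 2 ≤ 2 * kConst θ * auxEnergy K V θ R f u := by
  have hA := exists_isSobolevBound hs0 hn hK
  have hk := two_lt_kConst hf.two_lt_θ
  have hθ := hf.two_lt_θ
  have h1 := integrable_gAux (R := R) hA hf hV hu.1 hu.1.1.aem fun _ => le_rfl
  have h2 := integral_mono_of_nonneg
    (Eventually.of_forall fun x => primitive_gAux_nonneg (R := R) hf hV x (u x))
    ((h1.const_mul (1 / θ)).add (hu.1.2.const_mul (1 / (2 * kConst θ))))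
    (Eventually.of_forall fun x => primitive_gAux_le (R := R) hf hV x (u x))
  rw [integral_add' (h1.const_mul _) (hu.1.2.const_mul _), integral_const_mul,
    integral_const_mul] at h2
  have h3 := hu.2 u hu.1
  have h4 : ∫ x, V x * u x * u x = ∫ x, V x * u x ^ 2 := by congr 1; ext x; ring
  have h5 := form_self_nonneg hK.pos u
  unfold auxEnergy
  rw [← h3, h4, ← normE_sq hK.pos hV] at h2
  have h6 : ∫ x, V x * u x ^ 2 ≤ normE K V u ^ 2 := by rw [normE_sq hK.pos hV]; linarith
  set N := normE K V u ^ 2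
  have h7 : 1 / (2 * kConst θ) * ∫ x, V x * u x ^ 2 ≤ 1 / (2 * kConst θ) * N :=
    mul_le_mul_of_nonneg_left h6 (by positivity)
  -- This is the defining relation of k; it turns 1/2 - 1/θ - 1/(2k) into 1/(2k).
  have h8 : 1 / θ = 1 / 2 - 1 / kConst θ := by
    have : θ - 2 ≠ 0 := by linarith
    unfold kConst; field_simp; ring
  have h9 : N / (2 * kConst θ) ≤ 1 / 2 * N - ∫ x, primitive (gAux V θ R f x) (u x) := by
    have h10 : 1 / θ * N + 1 / (2 * kConst θ) * N = 1 / 2 * N - N / (2 * kConst θ) := by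
      rw [h8]; field_simp; ring
    linarith
  rw [div_le_iff₀ (by positivity)] at h9
  linarith

end Nonlinearity

/-! ### Comparison of the mountain pass levels -/

theorem MemX.sub {u v : Rn n → ℝ} (hu : MemX K u) (hv : MemX K v) : MemX K (u - v) := by
  refine ⟨hu.1.sub hv.1, ?_⟩
  convert hu.2.sub hv.2 using 1
  ext z
  simp only [Pi.sub_apply]
  ring

theorem MemX.const_mul {u : Rn n → ℝ} (hu : MemX K u) (c : ℝ) : MemX K (fun x => c * u x) := by
  refine ⟨hu.1.const_mul c, ?_⟩
  convert hu.2.const_mul c using 1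
  ext z
  ring

theorem normX_sq (hKp : ∀ x, 0 < K x) (u : Rn n → ℝ) :
    normX K u ^ 2 = (∫ x, u x ^ 2) + form K u u :=
  Real.sq_sqrt (add_nonneg (integral_nonneg fun _ => sq_nonneg _) (form_self_nonneg hKp u))

theorem normX_const_mul (c : ℝ) (u : Rn n → ℝ) :
    normX K (fun x => c * u x) = |c| * normX K u := by
  have h1 : form K (fun x => c * u x) (fun x => c * u x) = c ^ 2 * form K u u := by
    unfold form
    rw [← integral_const_mul]
    congr 1; ext z; ring
  have h2 : ∫ x, (c * u x) ^ 2 = c ^ 2 * ∫ x, u x ^ 2 := by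
    rw [← integral_const_mul]
    congr 1; ext z; ring
  rw [normX, h1, h2, ← mul_add, Real.sqrt_mul (sq_nonneg c), Real.sqrt_sq_eq_abs, normX]

theorem normX_sq_le (hKp : ∀ x, 0 < K x) {u v : Rn n → ℝ} (hu : MemX K u) (hv : MemX K v) :
    normX K u ^ 2 ≤ 2 * normX K v ^ 2 + 2 * normX K (u - v) ^ 2 := by
  have hw := hu.sub hv
  have h1 := integral_mono hu.integrable_sq
    ((hv.integrable_sq.const_mul 2).add (hw.integrable_sq.const_mul 2)) fun x => by
      simp only [Pi.add_apply, Pi.sub_apply]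
      nlinarith [sq_nonneg (u x - 2 * v x)]
  rw [integral_add' (hv.integrable_sq.const_mul 2) (hw.integrable_sq.const_mul 2),
    integral_const_mul, integral_const_mul] at h1
  have hvv := integrable_form hKp hv hv
  have hww := integrable_form hKp hw hw
  have h2 := integral_mono (integrable_form hKp hu hu)
    ((hvv.const_mul 2).add (hww.const_mul 2)) fun z => by
      have := (hKp (z.1 - z.2)).le
      simp only [Pi.add_apply, Pi.sub_apply]
      nlinarith [mul_nonneg (sq_nonneg (u z.1 - u z.2 - 2 * (v z.1 - v z.2))) this]
  rw [integral_add' (hvv.const_mul 2) (hww.const_mul 2), integral_const_mul,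
    integral_const_mul] at h2
  rw [normX_sq hKp, normX_sq hKp, normX_sq hKp]
  simp only [form] at *
  linarith

section Levels

variable {p c₀ θ Vinf R : ℝ} {f : ℝ → ℝ} {V e : Rn n → ℝ}

/-- Continuity gives local boundedness along the path, and compactness of [0,1] makes it global. -/
theorem bddAbove_normX_sq (hKp : ∀ x, 0 < K x) {W : (Rn n → ℝ) → Prop}
    (hW : ∀ w, W w → MemX K w) {γ : I → Rn n → ℝ} (hγ : γ ∈ paths W (normX K) e) :
    BddAbove (range fun t => normX K (γ t) ^ 2) := by
  rw [← image_univ]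
  refine isCompact_univ.induction_on (p := fun T => BddAbove ((fun t => normX K (γ t) ^ 2) '' T))
    (by simp) (fun T T' h h' => h'.mono (image_mono h))
    (fun T T' h h' => by rw [image_union]; exact h.union h') fun t₀ _ => ?_
  have h1 : ∀ᶠ t in 𝓝 t₀, normX K (γ t - γ t₀) < 1 :=
    (hγ.2.1 t₀).eventually_lt_const one_pos
  refine ⟨{t | normX K (γ t - γ t₀) < 1}, mem_nhdsWithin_of_mem_nhds h1,
    2 * normX K (γ t₀) ^ 2 + 2, ?_⟩
  rintro _ ⟨t, ht, rfl⟩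
  have h2 := normX_sq_le hKp (hW _ (hγ.1 t)) (hW _ (hγ.1 t₀))
  have h3 : 0 ≤ normX K (γ t - γ t₀) := Real.sqrt_nonneg _
  have h4 : normX K (γ t - γ t₀) < 1 := ht
  simp only
  nlinarith

theorem integral_potential_le (hV : IsPotential V Vinf) {w : Rn n → ℝ}
    (hw2 : Integrable (fun x => w x ^ 2))
    (hw : ∀ᵐ x, x ∉ Metric.ball (0 : Rn n) 1 → w x = 0) :
    ∫ x, V x * w x ^ 2 ≤ ∫ x, Vinf * w x ^ 2 := by
  refine integral_mono_of_nonneg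
    (Eventually.of_forall fun x => mul_nonneg (hV.pos x).le (sq_nonneg _))
    (hw2.const_mul Vinf) ?_
  filter_upwards [hw] with x hx
  by_cases hxB : x ∈ Metric.ball (0 : Rn n) 1
  · exact mul_le_mul_of_nonneg_right (hV.upper x hxB) (sq_nonneg _)
  · simp [hx hxB]

theorem MemX₀.memE (hV : IsPotential V Vinf) {w : Rn n → ℝ}
    (hw : MemX₀ K (Metric.ball 0 1) w) : MemE K V w := by
  refine ⟨hw.1, (hw.1.integrable_sq.const_mul Vinf).mono
    (hV.continuous.aestronglyMeasurable.mul (hw.1.aem.pow 2)) ?_⟩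
  filter_upwards [hw.2] with x hx
  by_cases hxB : x ∈ Metric.ball (0 : Rn n) 1
  · have h1 := hV.pos x
    have h2 := hV.Vinf_pos
    rw [Real.norm_of_nonneg (by positivity), Real.norm_of_nonneg (by positivity)]
    exact mul_le_mul_of_nonneg_right (hV.upper x hxB) (sq_nonneg _)
  · simp [hx hxB]

theorem MemX₀.sub {Ω : Set (Rn n)} {u v : Rn n → ℝ} (hu : MemX₀ K Ω u) (hv : MemX₀ K Ω v) :
    MemX₀ K Ω (u - v) := by
  refine ⟨hu.1.sub hv.1, ?_⟩
  filter_upwards [hu.2, hv.2] with x h1 h2 hx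
  simp [h1 hx, h2 hx]

theorem normE_le_mul_normX (hKp : ∀ x, 0 < K x) (hV : IsPotential V Vinf) {w : Rn n → ℝ}
    (hw : MemX₀ K (Metric.ball 0 1) w) : normE K V w ≤ √(1 + Vinf) * normX K w := by
  have hVi := hV.Vinf_pos
  rw [normE, normX, ← Real.sqrt_mul (by positivity)]
  apply Real.sqrt_le_sqrt
  have h1 := integral_potential_le hV hw.1.integrable_sq hw.2
  rw [integral_const_mul] at h1
  have h2 := form_self_nonneg hKp w
  have h3 : 0 ≤ ∫ x, w x ^ 2 := integral_nonneg fun _ => sq_nonneg _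
  nlinarith [mul_nonneg hVi.le h2]

theorem paths_ball_subset (hKp : ∀ x, 0 < K x) (hV : IsPotential V Vinf) :
    paths (MemX₀ K (Metric.ball 0 1)) (normX K) e ⊆ paths (MemE K V) (normE K V) e := by
  rintro γ ⟨h1, h2, h3⟩
  refine ⟨fun t => (h1 t).memE hV, fun t₀ => ?_, h3⟩
  have h4 := (h2 t₀).const_mul (√(1 + Vinf))
  rw [mul_zero] at h4
  exact squeeze_zero (fun t => Real.sqrt_nonneg _)
    (fun t => normE_le_mul_normX hKp hV ((h1 t).sub (h1 t₀))) h4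

theorem auxEnergy_le_ballEnergy (hKp : ∀ x, 0 < K x) (hV : IsPotential V Vinf) (hR : 1 ≤ R)
    {w : Rn n → ℝ} (hw : MemX₀ K (Metric.ball 0 1) w) :
    auxEnergy K V θ R f w ≤ ballEnergy K Vinf f w := by
  have h1 := integral_potential_le hV hw.1.integrable_sq hw.2
  have h2 : ∫ x, primitive (gAux V θ R f x) (w x) = ∫ x, primitive f (w x) := by
    refine integral_congr_ae ?_
    filter_upwards [hw.2] with x hx
    by_cases hxB : x ∈ Metric.ball (0 : Rn n) 1
    · have hxR : ‖x‖ ≤ R := by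
        rw [mem_ball_zero_iff] at hxB; linarith
      have : gAux V θ R f x = f := by ext t; simp [gAux, hxR]
      rw [this]
    · simp [hx hxB, primitive]
  unfold auxEnergy ballEnergy
  rw [normE_sq hKp hV, h2]
  linarith

/-- Needed because a real supremum of an unbounded family defaults to 0, which would spoil the
comparison of levels. -/
theorem bddAbove_ballEnergy (hKp : ∀ x, 0 < K x) (hf : IsNonlinearity n s p c₀ θ f)
    (hVinf : 0 < Vinf) {γ : I → Rn n → ℝ}
    (hγ : γ ∈ paths (MemX₀ K (Metric.ball 0 1)) (normX K) e) :
    BddAbove (range fun t => ballEnergy K Vinf f (γ t)) := by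
  obtain ⟨B, hB⟩ := bddAbove_normX_sq hKp (fun w hw => hw.1) hγ
  refine ⟨(1 + Vinf) * B, ?_⟩
  rintro _ ⟨t, rfl⟩
  have h1 : normX K (γ t) ^ 2 ≤ B := hB ⟨t, rfl⟩
  have h2 : 0 ≤ ∫ x, primitive f (γ t x) := integral_nonneg fun x =>
    primitive_nonneg_of_sign (fun _ _ => hf.nonneg _) (fun _ h => (hf.eq_zero h).le) _
  have h3 := form_self_nonneg hKp (γ t)
  have h4 : 0 ≤ ∫ x, γ t x ^ 2 := integral_nonneg fun _ => sq_nonneg _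
  rw [normX_sq hKp] at h1
  simp only [ballEnergy]
  rw [integral_const_mul]
  have h5 := mul_le_mul_of_nonneg_left h1 (by linarith : 0 ≤ 1 + Vinf)
  nlinarith [mul_nonneg hVinf.le h3, mul_nonneg hVinf.le h4]

theorem segment_mem_paths (he : MemX₀ K (Metric.ball 0 1) e) :
    (fun (t : I) x => (t : ℝ) * e x) ∈ paths (MemX₀ K (Metric.ball 0 1)) (normX K) e := by
  refine ⟨fun t => ⟨he.1.const_mul _, ?_⟩, fun t₀ => ?_, ?_, ?_⟩
  · filter_upwards [he.2] with x hx hxB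
    simp [hx hxB]
  · have h1 : ∀ t : I, normX K ((fun x => (t : ℝ) * e x) - fun x => (t₀ : ℝ) * e x) =
        |(t : ℝ) - t₀| * normX K e := fun t => by
      rw [← normX_const_mul]
      congr 1; ext x; simp only [Pi.sub_apply]; ring
    simp only [h1]
    have h2 : Continuous fun t : I => |(t : ℝ) - t₀| * normX K e := by fun_prop
    simpa using h2.tendsto t₀
  · exact Eventually.of_forall fun x => by simp
  · exact Eventually.of_forall fun x => by simp

/-- The energy vanishes at the starting point; if it is unbounded on the path, the default value 0
of the supremum suffices. -/
theorem iSup_auxEnergy_nonneg {γ : I → Rn n → ℝ}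
    (hγ : γ ∈ paths (MemE K V) (normE K V) e) : 0 ≤ ⨆ t, auxEnergy K V θ R f (γ t) := by
  by_cases hb : BddAbove (range fun t => auxEnergy K V θ R f (γ t))
  · refine le_trans ?_ (le_ciSup hb 0)
    have h1 : ∫ x, primitive (gAux V θ R f x) (γ 0 x) = 0 := by
      rw [← integral_zero (Rn n) ℝ]
      refine integral_congr_ae ?_
      filter_upwards [hγ.2.2.1] with x hx
      simp [hx, primitive]
    simp only [auxEnergy]
    rw [h1, sub_zero]
    exact mul_nonneg (by norm_num) (sq_nonneg _)
  · rw [Real.iSup_of_not_bddAbove hb]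

/-- Every admissible path in X₀(B) is admissible in E, and J ≤ I₀ along it. The segment to e shows
that such paths exist. -/
theorem auxLevel_le_ballLevel (hKp : ∀ x, 0 < K x) (hf : IsNonlinearity n s p c₀ θ f)
    (hV : IsPotential V Vinf) (he : MemX₀ K (Metric.ball 0 1) e) (hR : 1 ≤ R) :
    auxLevel K V θ R f e ≤ ballLevel K Vinf f e := by
  refine le_csInf ⟨_, _, segment_mem_paths he, rfl⟩ ?_
  rintro _ ⟨γ, hγ, rfl⟩
  have hbdd : BddBelow
      ((fun γ => ⨆ t : I, auxEnergy K V θ R f (γ t)) '' paths (MemE K V) (normE K V) e) :=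
    ⟨0, by rintro _ ⟨γ, hγ, rfl⟩; exact iSup_auxEnergy_nonneg hγ⟩
  refine (csInf_le hbdd ⟨γ, paths_ball_subset hKp hV hγ, rfl⟩).trans ?_
  exact ciSup_mono (bddAbove_ballEnergy hKp hf hV.Vinf_pos hγ)
    fun t => auxEnergy_le_ballEnergy hKp hV hR (hγ.1 t)

end Levels

/-! ### The Sobolev constant -/

theorem sobolevConst_nonneg : 0 ≤ sobolevConst n s K := Real.sInf_nonneg fun _ h => h.1

/-- Covers the degenerate value S = 0 without exhibiting a nonzero element of X: admissible
constants can be taken arbitrarily small. -/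
theorem rnorm_eq_zero_of_sobolevConst_eq_zero (hKp : ∀ x, 0 < K x) {A : ℝ}
    (hA : IsSobolevBound n s K A) (hS : sobolevConst n s K = 0) {u : Rn n → ℝ} (hu : MemX K u) :
    rnorm (critExp n s) u = 0 := by
  have hne : {C : ℝ | 0 ≤ C ∧ ∀ u : Rn n → ℝ, MemX K u →
      eLpNorm u (ENNReal.ofReal (critExp n s)) (volume : Measure (Rn n)) ^ 2
        ≤ ENNReal.ofReal (C * normX K u ^ 2)}.Nonempty := by
    refine ⟨A, hA.1.le, fun u hu => (hA.2 u hu).trans (ENNReal.ofReal_le_ofReal ?_)⟩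
    refine mul_le_mul_of_nonneg_left ?_ hA.1.le
    rw [normX_sq hKp]
    have : 0 ≤ ∫ x, u x ^ 2 := integral_nonneg fun _ => sq_nonneg _
    linarith
  have h1 : ∀ ε : ℝ, 0 < ε → rnorm (critExp n s) u ^ 2 ≤ ε * normX K u ^ 2 := fun ε hε => by
    obtain ⟨C, hC, hlt⟩ := exists_lt_of_csInf_lt hne (hS.trans_lt hε)
    have h := ENNReal.toReal_mono ENNReal.ofReal_ne_top (hC.2 u hu)
    rw [ENNReal.toReal_ofReal (mul_nonneg hC.1 (sq_nonneg _)), ENNReal.toReal_pow] at h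
    exact h.trans (mul_le_mul_of_nonneg_right hlt.le (sq_nonneg _))
  have h2 : rnorm (critExp n s) u ^ 2 ≤ 0 := by
    have hlim : Tendsto (fun ε : ℝ => ε * normX K u ^ 2) (𝓝[>] 0) (𝓝 (0 * normX K u ^ 2)) :=
      ((continuous_id.mul continuous_const).tendsto 0).mono_left nhdsWithin_le_nhds
    rw [zero_mul] at hlim
    exact ge_of_tendsto hlim (eventually_nhdsWithin_of_forall h1)
  exact pow_eq_zero_iff (two_ne_zero) |>.1 (le_antisymm h2 (sq_nonneg _))

/-- The ratio between the homogeneous Sobolev bound and the Sobolev constant of `X`. -/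
noncomputable def sobolevRatio (A S : ℝ) : ℝ := open Classical in if S = 0 then 1 else A / S

theorem sobolevRatio_pos {A S : ℝ} (hA : 0 < A) (hS : 0 ≤ S) : 0 < sobolevRatio A S := by
  unfold sobolevRatio
  split_ifs with h
  · exact one_pos
  · exact div_pos hA (lt_of_le_of_ne hS (Ne.symm h))

theorem rnorm_sq_le_of_form_le (hKp : ∀ x, 0 < K x) {A : ℝ} (hA : IsSobolevBound n s K A)
    {u : Rn n → ℝ} (hu : MemX K u) {k d : ℝ} (hform : form K u u ≤ 2 * k * d) :
    rnorm (critExp n s) u ^ 2 ≤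
      sobolevRatio A (sobolevConst n s K) * (2 * sobolevConst n s K * k * d) := by
  by_cases hS : sobolevConst n s K = 0
  · rw [rnorm_eq_zero_of_sobolevConst_eq_zero hKp hA hS hu, hS]; simp
  · rw [sobolevRatio, if_neg hS]
    calc _ ≤ A * form K u u := hA.rnorm_sq_le hKp hu
      _ ≤ A * (2 * k * d) := mul_le_mul_of_nonneg_left hform hA.1.le
      _ = _ := by field_simp

/-! ### The weight c|u|^(p-2) in L^q -/

theorem memLp_mul_rpow {P p c : ℝ} (hp : 2 < p) {u : Rn n → ℝ}
    (hu : MemLp u (ENNReal.ofReal P) volume) :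
    MemLp (fun x => c * |u x| ^ (p - 2)) (ENNReal.ofReal (P / (p - 2))) volume := by
  have h := hu.norm_rpow_div (ENNReal.ofReal (p - 2))
  rw [← ENNReal.ofReal_div_of_pos (by linarith), ENNReal.toReal_ofReal (by linarith)] at h
  exact h.const_mul c

theorem rnorm_mul_rpow {P p c : ℝ} (hP : 0 < P) (hp : 2 < p) (hc : 0 ≤ c) (u : Rn n → ℝ) :
    rnorm (P / (p - 2)) (fun x => c * |u x| ^ (p - 2)) = c * rnorm P u ^ (p - 2) := by
  have hp' : 0 < p - 2 := by linarith
  have h1 : (fun x => c * |u x| ^ (p - 2)) = c • fun x => ‖u x‖ ^ (p - 2) := by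
    ext x; simp
  rw [rnorm, h1, eLpNorm_const_smul, eLpNorm_norm_rpow _ hp', ← ENNReal.ofReal_mul (by positivity),
    div_mul_cancel₀ _ hp'.ne', ENNReal.toReal_mul, ← ENNReal.toReal_rpow, rnorm]
  simp [abs_of_nonneg hc]

theorem lt_critExp_div (hs0 : 0 < s) (hn : 2 * s < n) {p : ℝ} (hp : 2 < p)
    (hpP : p < critExp n s) : n / (2 * s) < critExp n s / (p - 2) := by
  have hP := critExp_gt_two hs0 hn
  rw [← critExp_div hs0 hn]
  exact div_lt_div_of_pos_left (by linarith) (by linarith) (by linarith)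

end NonlocalSchrodinger

/-! ### Assembly of the estimates -/

theorem lemma5p1 (n : ℕ) (s : ℝ) (hs0 : 0 < s) (hs1 : s < 1) (hn : 2 * s < n)
    (K : NonlocalSchrodinger.Rn n → ℝ) (hK : NonlocalSchrodinger.IsKernel n s K) :
    ∃ (M : ℝ → ℝ → ℝ) (C : ℝ), 0 < C ∧
      (∀ q : ℝ, n / (2 * s) < q → MonotoneOn (M q) (Set.Ici 0)) ∧
      ∀ (p c₀ θ : ℝ) (f : ℝ → ℝ) (V : NonlocalSchrodinger.Rn n → ℝ) (Vinf : ℝ)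
        (e : NonlocalSchrodinger.Rn n → ℝ) (R : ℝ) (u : NonlocalSchrodinger.Rn n → ℝ),
        NonlocalSchrodinger.IsNonlinearity n s p c₀ θ f →
        NonlocalSchrodinger.IsPotential V Vinf →
        NonlocalSchrodinger.MemX₀ K (Metric.ball 0 1) e →
        NonlocalSchrodinger.ballEnergy K Vinf f e < 0 →
        1 ≤ R →
        NonlocalSchrodinger.IsAuxSolution K V θ R f u →
        NonlocalSchrodinger.auxEnergy K V θ R f u =
          NonlocalSchrodinger.auxLevel K V θ R f e →
        let S := NonlocalSchrodinger.sobolevConst n s K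
        let k := NonlocalSchrodinger.kConst θ
        let d := NonlocalSchrodinger.ballLevel K Vinf f e
        let q := NonlocalSchrodinger.critExp n s / (p - 2)
        let h := fun x => c₀ * |u x| ^ (p - 2)
        n / (2 * s) < q ∧
        MemLp h (ENNReal.ofReal q) volume ∧
        (eLpNorm h (ENNReal.ofReal q) volume).toReal
          ≤ c₀ * (C * (2 * S * k * d)) ^ ((p - 2) / 2) ∧
        eLpNorm u ∞ volume
          ≤ ENNReal.ofReal
              (M q (eLpNorm h (ENNReal.ofReal q) volume).toReal * √(2 * S * k * d)) := by
  obtain ⟨A, hA⟩ := NonlocalSchrodinger.exists_isSobolevBound hs0 hn hK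
  have hP := NonlocalSchrodinger.critExp_gt_two hs0 hn
  have hC := NonlocalSchrodinger.sobolevRatio_pos hA.1
    (NonlocalSchrodinger.sobolevConst_nonneg (n := n) (s := s) (K := K))
  -- The ratio A/S trades the homogeneous constant A for S: A · 2kd = (A/S) · 2Skd. Its square root
  -- enters M because ‖u‖_P, not its square, appears in the sup bound.
  refine ⟨fun q r => NonlocalSchrodinger.supFactor A
      (NonlocalSchrodinger.gain (NonlocalSchrodinger.critExp n s) q) r *
      √(NonlocalSchrodinger.sobolevRatio A (NonlocalSchrodinger.sobolevConst n s K)),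
    NonlocalSchrodinger.sobolevRatio A (NonlocalSchrodinger.sobolevConst n s K), hC,
    fun q hq r hr r' hr' hrr' => mul_le_mul_of_nonneg_right
      (NonlocalSchrodinger.monotoneOn_supFactor hA.1
        (NonlocalSchrodinger.gain_pos hs0 hn hq) hr hr' hrr') (Real.sqrt_nonneg _), ?_⟩
  intro p c₀ θ f V Vinf e R u hf hV he _ hR hu hJ S k d q h
  have hq : n / (2 * s) < q := NonlocalSchrodinger.lt_critExp_div hs0 hn hf.two_lt_p hf.p_lt
  have hLp := hA.memLp hu.1.1
  have hh : MemLp h (ENNReal.ofReal q) volume :=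
    NonlocalSchrodinger.memLp_mul_rpow hf.two_lt_p hLp
  have hk : 0 < k := by linarith [NonlocalSchrodinger.two_lt_kConst hf.two_lt_θ]
  have hform : NonlocalSchrodinger.form K u u ≤ 2 * k * d := by
    have h1 := hu.normE_sq_le hs0 hn hK hf hV
    rw [NonlocalSchrodinger.normE_sq hK.pos hV, hJ] at h1
    have h2 := NonlocalSchrodinger.integral_potential_nonneg hV u
    have h3 : 2 * k * NonlocalSchrodinger.auxLevel K V θ R f e ≤ 2 * k * d :=
      mul_le_mul_of_nonneg_left
        (NonlocalSchrodinger.auxLevel_le_ballLevel hK.pos hf hV he hR) (by linarith)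
    linarith
  have hnorm := NonlocalSchrodinger.rnorm_sq_le_of_form_le hK.pos hA hu.1.1 hform
  set N := NonlocalSchrodinger.rnorm (NonlocalSchrodinger.critExp n s) u with hN
  have hN0 : 0 ≤ N := ENNReal.toReal_nonneg
  have hNle : N ≤ √(NonlocalSchrodinger.sobolevRatio A S * (2 * S * k * d)) :=
    Real.le_sqrt_of_sq_le hnorm
  refine ⟨hq, hh, ?_, ?_⟩
  · have h1 := NonlocalSchrodinger.rnorm_mul_rpow (P := NonlocalSchrodinger.critExp n s)
      (by linarith) hf.two_lt_p hf.c₀_pos.le u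
    refine h1.le.trans (mul_le_mul_of_nonneg_left ?_ hf.c₀_pos.le)
    have hp := hf.two_lt_p
    refine (Real.rpow_le_rpow hN0 hNle (by linarith)).trans (le_of_eq ?_)
    rw [Real.sqrt_eq_rpow, ← Real.rpow_mul ((sq_nonneg N).trans hnorm)]
    congr 1; ring
  · have hh0 : ∀ x, 0 ≤ h x := fun x =>
      mul_nonneg hf.c₀_pos.le (Real.rpow_nonneg (abs_nonneg _) _)
    have h1 := (hu.isSubsolution hs0 hn hK hf hV).le hs0 hn hK hA hq hh0 hh hu.1.1
    have h2 := (hu.isSubsolution_neg hs0 hn hK hf hV).le hs0 hn hK hA hq hh0 hh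
      (hu.1.1.neg hK.measurable)
    have hneg : NonlocalSchrodinger.rnorm (NonlocalSchrodinger.critExp n s) (fun x => -u x) = N := by
      rw [hN, NonlocalSchrodinger.rnorm, NonlocalSchrodinger.rnorm, ← eLpNorm_neg]
      congr 2; ext x; simp
    rw [hneg] at h2
    have hM := NonlocalSchrodinger.supFactor_pos
      (η := NonlocalSchrodinger.gain (NonlocalSchrodinger.critExp n s) q) hA.1
      (ENNReal.toReal_nonneg : 0 ≤ NonlocalSchrodinger.rnorm q h)
    refine (eLpNorm_le_of_ae_bound (p := ∞)
      (C := NonlocalSchrodinger.supFactor A (NonlocalSchrodinger.gain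
        (NonlocalSchrodinger.critExp n s) q) (NonlocalSchrodinger.rnorm q h) * N) ?_).trans ?_
    · filter_upwards [h1, h2] with x hx1 hx2
      exact abs_le.2 ⟨by linarith, hx1⟩
    -- At exponent ∞ the measure of the whole space enters with power 0, so its infinite value is
    -- harmless.
    · simp only [ENNReal.toReal_top, inv_zero, ENNReal.rpow_zero, one_mul]
      apply ENNReal.ofReal_le_ofReal
      rw [mul_assoc, ← Real.sqrt_mul hC.le]
      exact mul_le_mul_of_nonneg_left hNle hM.le
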